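/- Let $M$ be a smooth $n$-dimensional manifold, $\pi:E\to M$ a smooth vector bundle of rank $m$ and $(E,[\cdot,\cdot]_E,\sigma)$ a Lie algebroid over $M$. In local coordinates $(x^i)$ on $U\subset M$ and a local basis $\{s_\alpha\}$ of sections of $E$ over $U$, with induced coordinates $(x^i,y^\alpha)$ on $E$, write $\sigma(s_\alpha)=\sigma^i_\alpha\,\partial/\partial x^i$ and $[s_\alpha,s_\beta]_E=L^\gamma_{\alpha\beta}s_\gamma$. Let $\mathcal T E\to E$ be the prolongation of $E$ over $\pi$, i.e. the Lie algebroid over $E$ with local basis $\mathcal X_\alpha=(s_\alpha,\sigma^i_\alpha\,\partial/\partial x^i)$, $\mathcal V_\alpha=(0,\partial/\partial y^\alpha)$, with anchor $\mathcal X_\alpha\mapsto\sigma_\alpha^i\,\partial/\partial x^i$, $\mathcal V_\alpha\mapsto\partial/\partial y^\alpha$ and brackets $[\mathcal X_\alpha,\mathcal X_\beta]=L^\gamma_{\alpha\beta}\mathcal X_\gamma$, $[\mathcal X_\alpha,\mathcal V_\beta]=[\mathcal V_\alpha,\mathcal V_\beta]=0$. Let $\mathcal F:E\to[0,\infty)$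 be a Finsler function: $\mathcal F$ is $C^\infty$ on $E\setminus\{0\}$, $\mathcal F(\lambda u)=\lambda\mathcal F(u)$ for $\lambda>0$, and $g_{\alpha\beta}=\frac12\,\partial^2\mathcal F^2/\partial y^\alpha\partial y^\beta$ is positive definite on $E\setminus\{0\}$. Put $\mathcal L=\frac12\mathcal F^2$, $y_\alpha=g_{\alpha\beta}y^\beta$, $$\mathcal S^\varepsilon=g^{\varepsilon\beta}\Big(\sigma^i_\beta\frac{\partial\mathcal L}{\partial x^i}-\sigma^i_\alpha y^\alpha\frac{\partial^2\mathcal L}{\partial x^i\partial y^\beta}-L^\theta_{\beta\alpha}y^\alpha\frac{\partial\mathcal L}{\partial y^\theta}\Big),\qquad \mathcal N_\alpha^\beta=\frac12\Big(-\frac{\partial\mathcal S^\beta}{\partial y^\alpha}+y^\varepsilon L^\beta_{\alpha\varepsilon}\Big),$$ the coefficients of the canonical nonlinear connection of $\mathcal F$, let $\delta_\alpha=\mathcal X_\alpha-\mathcal N_\alpha^\beta\mathcal V_\beta$, acting on functions on $E$ through the anchor, and let $$\mathcal R^\gamma_{\alpha\beta}=\sigma^i_\beta\frac{\partial\mathcal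 N^\gamma_\alpha}{\partial x^i}-\sigma^i_\alpha\frac{\partial\mathcal N^\gamma_\beta}{\partial x^i}-\mathcal N^\varepsilon_\beta\frac{\partial\mathcal N^\gamma_\alpha}{\partial y^\varepsilon}+\mathcal N^\varepsilon_\alpha\frac{\partial\mathcal N^\gamma_\beta}{\partial y^\varepsilon}+L^\varepsilon_{\alpha\beta}\mathcal N^\gamma_\varepsilon$$ be the components of its curvature. For a constant $a>0$ let $\mathbb F_0$ be the almost complex structure on $\mathcal T E$ over $E\setminus\{0\}$ given by $$\mathbb F_0(\delta_\alpha)=-\frac{\mathcal F}{a}\,\mathcal V_\alpha,\qquad \mathbb F_0(\mathcal V_\alpha)=\frac{a}{\mathcal F}\,\delta_\alpha .$$ Then $\mathbb F_0$ is integrable, i.e. its Nijenhuis tensor $\mathbf N(z,w)=[\mathbb F_0z,\mathbb F_0w]-\mathbb F_0[\mathbb F_0z,w]-\mathbb F_0[z,\mathbb F_0w]+\mathbb F_0^2[z,w]$ vanishes over $E\setminus\{0\}$, if and only if in all such local coordinates, on $E\setminus\{0\}$ and for all $\alpha,\beta,\gamma\in\{1,\dots,m\}$, $$\mathcal R^\gamma_{\alpha\beta}=\frac1{a^2}\big(y_\alpha\delta^\gamma_\beta-y_\beta\delta^\gamma_\alpha\big)\qquad\text{and}\qquad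 \delta_\alpha(\mathcal F^2)\,\delta^\gamma_\beta=\delta_\beta(\mathcal F^2)\,\delta^\gamma_\alpha .$$ -/

import Mathlib

open scoped Manifold ContDiff Bundle

noncomputable section

/-- Multiplication of a smooth section of a vector bundle by a smooth function on the base. -/
def smulSection {n m : ℕ} {M : Type*} [TopologicalSpace M]
    [ChartedSpace (EuclideanSpace ℝ (Fin n)) M]
    {E : M → Type*} [∀ x, AddCommGroup (E x)] [∀ x, Module ℝ (E x)]
    [∀ x, TopologicalSpace (E x)]
    [TopologicalSpace (Bundle.TotalSpace (EuclideanSpace ℝ (Fin m)) E)]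
    [FiberBundle (EuclideanSpace ℝ (Fin m)) E] [VectorBundle ℝ (EuclideanSpace ℝ (Fin m)) E]
    (f : M → ℝ) (hf : ContMDiff (𝓡 n) 𝓘(ℝ, ℝ) ∞ f)
    (s : Cₛ^∞⟮𝓡 n; EuclideanSpace ℝ (Fin m), E⟯) :
    Cₛ^∞⟮𝓡 n; EuclideanSpace ℝ (Fin m), E⟯ :=
  ⟨fun x => f x • s x, hf.smul_section s.contMDiff⟩

/-- A Lie algebroid: a smooth vector bundle `E` of rank `m` over an `n`-dimensional manifold `M`,
a Lie bracket on the space of smooth sections of `E`, and a smooth bundle map `E → TM` (the anchor)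
which is a homomorphism to the Lie algebra of vector fields and satisfies the Leibniz rule. -/
structure LieAlgebroid (n m : ℕ) (M : Type*) [TopologicalSpace M]
    [ChartedSpace (EuclideanSpace ℝ (Fin n)) M] [IsManifold (𝓡 n) ∞ M]
    (E : M → Type*) [∀ x, AddCommGroup (E x)] [∀ x, Module ℝ (E x)]
    [∀ x, TopologicalSpace (E x)]
    [TopologicalSpace (Bundle.TotalSpace (EuclideanSpace ℝ (Fin m)) E)]
    [FiberBundle (EuclideanSpace ℝ (Fin m)) E] [VectorBundle ℝ (EuclideanSpace ℝ (Fin m)) E]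
    [ContMDiffVectorBundle ∞ (EuclideanSpace ℝ (Fin m)) E (𝓡 n)] where
  /-- The bracket of sections. -/
  bracket : Cₛ^∞⟮𝓡 n; EuclideanSpace ℝ (Fin m), E⟯ →ₗ[ℝ]
    Cₛ^∞⟮𝓡 n; EuclideanSpace ℝ (Fin m), E⟯ →ₗ[ℝ] Cₛ^∞⟮𝓡 n; EuclideanSpace ℝ (Fin m), E⟯
  bracket_self : ∀ s, bracket s s = 0
  jacobi : ∀ s t u,
    bracket s (bracket t u) + bracket t (bracket u s) + bracket u (bracket s t) = 0
  /-- The anchor. -/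
  anchor : ∀ x : M, E x →ₗ[ℝ] TangentSpace (𝓡 n) x
  anchor_smooth : ContMDiff ((𝓡 n).prod 𝓘(ℝ, EuclideanSpace ℝ (Fin m))) (𝓡 n).tangent ∞
    (fun w : Bundle.TotalSpace (EuclideanSpace ℝ (Fin m)) E =>
      (⟨w.1, anchor w.1 w.2⟩ : TangentBundle (𝓡 n) M))
  anchor_bracket : ∀ s t x, anchor x (bracket s t x) =
    VectorField.mlieBracket (𝓡 n) (fun y => anchor y (s y)) (fun y => anchor y (t y)) x
  leibniz : ∀ s (f : M → ℝ) (hf : ContMDiff (𝓡 n) 𝓘(ℝ, ℝ) ∞ f) t x,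
    bracket s (smulSection f hf t) x =
      f x • bracket s t x + (show ℝ from mfderiv (𝓡 n) 𝓘(ℝ, ℝ) f x (anchor x (s x))) • t x

/-- Local coordinates on the total space of `E`: a chart `(xⁱ)` of the smooth structure of `M`
and smooth sections `s_α` of `E` forming a basis of every fibre over the domain `U` of the chart.
(Near every point every local frame is the restriction of such sections.) A point of `E` over `U`
has the coordinates `(x, y)` with `y` its components in the basis `s_α`. -/
structure LocalCoordinates (n m : ℕ) (M : Type*) [TopologicalSpace M]
    [ChartedSpace (EuclideanSpace ℝ (Fin n)) M] [IsManifold (𝓡 n) ∞ M]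
    (E : M → Type*) [∀ x, AddCommGroup (E x)] [∀ x, Module ℝ (E x)]
    [∀ x, TopologicalSpace (E x)]
    [TopologicalSpace (Bundle.TotalSpace (EuclideanSpace ℝ (Fin m)) E)]
    [FiberBundle (EuclideanSpace ℝ (Fin m)) E] where
  /-- The chart of `M`. -/
  chart : OpenPartialHomeomorph M (EuclideanSpace ℝ (Fin n))
  chart_mem : chart ∈ IsManifold.maximalAtlas (𝓡 n) ∞ M
  /-- The sections `s_α`. -/
  frame : Fin m → Cₛ^∞⟮𝓡 n; EuclideanSpace ℝ (Fin m), E⟯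
  isFrame : IsLocalFrameOn (𝓡 n) (EuclideanSpace ℝ (Fin m)) ∞
    (fun α x => frame α x) chart.source

/-- The space of coordinates `(x, y)`. -/
abbrev Coord (n m : ℕ) : Type := EuclideanSpace ℝ (Fin n) × (Fin m → ℝ)

/-- `∂f/∂xⁱ`. -/
def partialX {n m : ℕ} (i : Fin n) (f : Coord n m → ℝ) (p : Coord n m) : ℝ :=
  fderiv ℝ f p (EuclideanSpace.single i 1, 0)

/-- `∂f/∂y^α`. -/
def partialY {n m : ℕ} (α : Fin m) (f : Coord n m → ℝ) (p : Coord n m) : ℝ :=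
  fderiv ℝ f p (0, Pi.single α 1)

namespace LocalCoordinates

variable {n m : ℕ} {M : Type*} [TopologicalSpace M]
  [ChartedSpace (EuclideanSpace ℝ (Fin n)) M] [IsManifold (𝓡 n) ∞ M]
  {E : M → Type*} [∀ x, AddCommGroup (E x)] [∀ x, Module ℝ (E x)]
  [∀ x, TopologicalSpace (E x)]
  [TopologicalSpace (Bundle.TotalSpace (EuclideanSpace ℝ (Fin m)) E)]
  [FiberBundle (EuclideanSpace ℝ (Fin m)) E]

/-- The coordinate image of the part of `E ∖ {0}` that lies over the domain of the chart. -/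
def domain (c : LocalCoordinates n m M E) : Set (Coord n m) :=
  {p | p.1 ∈ c.chart.target ∧ p.2 ≠ 0}

/-- The point of `E` with coordinates `(x, y)`. -/
def point (c : LocalCoordinates n m M E) (p : Coord n m) :
    Bundle.TotalSpace (EuclideanSpace ℝ (Fin m)) E :=
  ⟨c.chart.symm p.1, ∑ α, p.2 α • c.frame α (c.chart.symm p.1)⟩

/-- A function on `E` in coordinates. -/
def read (c : LocalCoordinates n m M E)
    (F : Bundle.TotalSpace (EuclideanSpace ℝ (Fin m)) E → ℝ) (p : Coord n m) : ℝ :=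
  F (c.point p)

/-- `g_{αβ} = ½ ∂²F²/∂y^α∂y^β`. -/
def metric (c : LocalCoordinates n m M E)
    (F : Bundle.TotalSpace (EuclideanSpace ℝ (Fin m)) E → ℝ) (p : Coord n m) :
    Matrix (Fin m) (Fin m) ℝ :=
  Matrix.of fun α β => (1 / 2 : ℝ) * partialY α (partialY β (fun q => c.read F q ^ 2)) p

/-- `y_α = g_{αβ} y^β`. -/
def lowerY (c : LocalCoordinates n m M E)
    (F : Bundle.TotalSpace (EuclideanSpace ℝ (Fin m)) E → ℝ) (α : Fin m) (p : Coord n m) : ℝ :=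
  ∑ β, c.metric F p α β * p.2 β

/-- The Lagrangian `½F²` in coordinates. -/
def lagrangian (c : LocalCoordinates n m M E)
    (F : Bundle.TotalSpace (EuclideanSpace ℝ (Fin m)) E → ℝ) (p : Coord n m) : ℝ :=
  (1 / 2 : ℝ) * c.read F p ^ 2

end LocalCoordinates

/-- Finsler functions on a vector bundle: nonnegative, smooth off the zero section, positively
homogeneous of degree one, with positive definite `g_{αβ}` off the zero section. -/
structure IsFinslerFunction (n : ℕ) {m : ℕ} {M : Type*} [TopologicalSpace M]
    [ChartedSpace (EuclideanSpace ℝ (Fin n)) M] [IsManifold (𝓡 n) ∞ M]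
    {E : M → Type*} [∀ x, AddCommGroup (E x)] [∀ x, Module ℝ (E x)]
    [∀ x, TopologicalSpace (E x)]
    [TopologicalSpace (Bundle.TotalSpace (EuclideanSpace ℝ (Fin m)) E)]
    [FiberBundle (EuclideanSpace ℝ (Fin m)) E]
    (F : Bundle.TotalSpace (EuclideanSpace ℝ (Fin m)) E → ℝ) : Prop where
  nonneg : ∀ w, 0 ≤ F w
  smooth : ContMDiffOn ((𝓡 n).prod 𝓘(ℝ, EuclideanSpace ℝ (Fin m))) 𝓘(ℝ, ℝ) ∞ F
    {w | w.2 ≠ 0}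
  homogeneous : ∀ (x : M) (u : E x) (r : ℝ), 0 < r → F ⟨x, r • u⟩ = r * F ⟨x, u⟩
  posDef : ∀ (c : LocalCoordinates n m M E), ∀ p ∈ c.domain, (c.metric F p).PosDef

/-- Sections of the prolongation `𝒯E` over a coordinate domain, through their components:
`(Z, V)` stands for `Z^α 𝒳_α + V^α 𝒱_α`, where
`𝒳_α(u) = (s_α(π(u)), σ_α^i ∂/∂xⁱ|_u)` and `𝒱_α(u) = (0, ∂/∂y^α|_u)`. -/
abbrev ProlongationSection (n m : ℕ) : Type :=
  (Coord n m → Fin m → ℝ) × (Coord n m → Fin m → ℝ)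

namespace ProlongationSection

variable {n m : ℕ}

/-- The basis section `𝒳_α`. -/
def frameX (α : Fin m) : ProlongationSection n m := (fun _ => Pi.single α 1, 0)

/-- The basis section `𝒱_α`. -/
def frameV (α : Fin m) : ProlongationSection n m := (0, fun _ => Pi.single α 1)

/-- Product of a function and a section. -/
def mulFun (f : Coord n m → ℝ) (z : ProlongationSection n m) : ProlongationSection n m :=
  (fun p => f p • z.1 p, fun p => f p • z.2 p)

/-- Smoothness of a section on a set. -/
def SmoothOn (z : ProlongationSection n m) (D : Set (Coord n m)) : Prop :=
  ContDiffOn ℝ ∞ z.1 D ∧ ContDiffOn ℝ ∞ z.2 D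

end ProlongationSection

namespace LieAlgebroid

open ProlongationSection

variable {n m : ℕ} {M : Type*} [TopologicalSpace M]
  [ChartedSpace (EuclideanSpace ℝ (Fin n)) M] [IsManifold (𝓡 n) ∞ M]
  {E : M → Type*} [∀ x, AddCommGroup (E x)] [∀ x, Module ℝ (E x)]
  [∀ x, TopologicalSpace (E x)]
  [TopologicalSpace (Bundle.TotalSpace (EuclideanSpace ℝ (Fin m)) E)]
  [FiberBundle (EuclideanSpace ℝ (Fin m)) E] [VectorBundle ℝ (EuclideanSpace ℝ (Fin m)) E]
  [ContMDiffVectorBundle ∞ (EuclideanSpace ℝ (Fin m)) E (𝓡 n)]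

/-- The structure functions `σ_α^i`, given by `σ(s_α) = σ_α^i ∂/∂xⁱ`. -/
def structSigma (A : LieAlgebroid n m M E) (c : LocalCoordinates n m M E)
    (α : Fin m) (i : Fin n) (x : EuclideanSpace ℝ (Fin n)) : ℝ :=
  (show EuclideanSpace ℝ (Fin n) from
    mfderiv (𝓡 n) (𝓡 n) c.chart (c.chart.symm x)
      (A.anchor (c.chart.symm x) (c.frame α (c.chart.symm x)))) i

/-- The structure functions `L_{αβ}^γ`, given by `[s_α, s_β] = L_{αβ}^γ s_γ`. -/
def structL (A : LieAlgebroid n m M E) (c : LocalCoordinates n m M E)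
    (α β γ : Fin m) (x : EuclideanSpace ℝ (Fin n)) : ℝ :=
  c.isFrame.coeff γ (c.chart.symm x) (A.bracket (c.frame α) (c.frame β) (c.chart.symm x))

/-- The anchor of `𝒯E`: the derivative of `f` along `Z^α σ_α^i ∂/∂xⁱ + V^α ∂/∂y^α`. -/
def derivAlong (A : LieAlgebroid n m M E) (c : LocalCoordinates n m M E)
    (z : ProlongationSection n m) (f : Coord n m → ℝ) (p : Coord n m) : ℝ :=
  ∑ α, ∑ i, z.1 p α * A.structSigma c α i p.1 * partialX i f p
    + ∑ α, z.2 p α * partialY α f p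

/-- The Lie bracket of sections of `𝒯E`: the Leibniz extension of
`[𝒳_α, 𝒳_β] = L_{αβ}^γ 𝒳_γ`, `[𝒳_α, 𝒱_β] = 0`, `[𝒱_α, 𝒱_β] = 0`. -/
def prolongBracket (A : LieAlgebroid n m M E) (c : LocalCoordinates n m M E)
    (z w : ProlongationSection n m) : ProlongationSection n m :=
  (fun p γ => A.derivAlong c z (fun q => w.1 q γ) p - A.derivAlong c w (fun q => z.1 q γ) p
      + ∑ α, ∑ β, z.1 p α * w.1 p β * A.structL c α β γ p.1,
   fun p γ => A.derivAlong c z (fun q => w.2 q γ) p - A.derivAlong c w (fun q => z.2 q γ) p)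

/-- The Nijenhuis tensor `[Tz, Tw] - T[Tz, w] - T[z, Tw] + T²[z, w]` of an endomorphism `T`. -/
def nijenhuis (A : LieAlgebroid n m M E) (c : LocalCoordinates n m M E)
    (T : ProlongationSection n m → ProlongationSection n m)
    (z w : ProlongationSection n m) : ProlongationSection n m :=
  A.prolongBracket c (T z) (T w) - T (A.prolongBracket c (T z) w)
    - T (A.prolongBracket c z (T w)) + T (T (A.prolongBracket c z w))

/-- The coefficients of the semispray `y^α 𝒳_α + S^α 𝒱_α` of the Lagrangian `ℒ = ½F²`,
`S^ε = g^{εβ}(σ_β^i ∂ℒ/∂xⁱ - σ_α^i y^α ∂²ℒ/∂xⁱ∂y^β - L_{βα}^θ y^α ∂ℒ/∂y^θ)`. -/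
def spray (A : LieAlgebroid n m M E)
    (F : Bundle.TotalSpace (EuclideanSpace ℝ (Fin m)) E → ℝ) (c : LocalCoordinates n m M E)
    (ε : Fin m) (p : Coord n m) : ℝ :=
  ∑ β, (c.metric F p)⁻¹ ε β *
    (∑ i, A.structSigma c β i p.1 * partialX i (c.lagrangian F) p
      - ∑ α, ∑ i, A.structSigma c α i p.1 * p.2 α *
          partialX i (partialY β (c.lagrangian F)) p
      - ∑ α, ∑ θ, A.structL c β α θ p.1 * p.2 α * partialY θ (c.lagrangian F) p)

/-- The coefficients `𝒩_α^β = ½(-∂S^β/∂y^α + y^ε L_{αε}^β)` of the canonical nonlinear connection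
of a Finsler function. -/
def connection (A : LieAlgebroid n m M E)
    (F : Bundle.TotalSpace (EuclideanSpace ℝ (Fin m)) E → ℝ) (c : LocalCoordinates n m M E)
    (α β : Fin m) (p : Coord n m) : ℝ :=
  (1 / 2 : ℝ) * (-partialY α (A.spray F c β) p + ∑ ε, p.2 ε * A.structL c α ε β p.1)

/-- The horizontal basis sections `δ_α = 𝒳_α - 𝒩_α^β 𝒱_β`. -/
def delta (A : LieAlgebroid n m M E)
    (F : Bundle.TotalSpace (EuclideanSpace ℝ (Fin m)) E → ℝ) (c : LocalCoordinates n m M E)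
    (α : Fin m) : ProlongationSection n m :=
  frameX α - ∑ β, mulFun (A.connection F c α β) (frameV β)

/-- The components
`ℛ_{αβ}^γ = σ_β^i ∂𝒩_α^γ/∂xⁱ - σ_α^i ∂𝒩_β^γ/∂xⁱ - 𝒩_β^ε ∂𝒩_α^γ/∂y^ε + 𝒩_α^ε ∂𝒩_β^γ/∂y^ε
+ L_{αβ}^ε 𝒩_ε^γ` of the curvature of the connection. -/
def curvature (A : LieAlgebroid n m M E)
    (F : Bundle.TotalSpace (EuclideanSpace ℝ (Fin m)) E → ℝ) (c : LocalCoordinates n m M E)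
    (α β γ : Fin m) (p : Coord n m) : ℝ :=
  ∑ i, A.structSigma c β i p.1 * partialX i (A.connection F c α γ) p
    - ∑ i, A.structSigma c α i p.1 * partialX i (A.connection F c β γ) p
    - ∑ ε, A.connection F c β ε p * partialY ε (A.connection F c α γ) p
    + ∑ ε, A.connection F c α ε p * partialY ε (A.connection F c β γ) p
    + ∑ ε, A.structL c α β ε p.1 * A.connection F c ε γ p

/-- The almost complex structure with `δ_α ↦ -(F/a) 𝒱_α` and `𝒱_α ↦ (a/F) δ_α`. A section
`Z^α 𝒳_α + V^α 𝒱_α` equals `Z^α δ_α + (V^α + Z^β 𝒩_β^α) 𝒱_α`. -/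
def almostComplex (A : LieAlgebroid n m M E)
    (F : Bundle.TotalSpace (EuclideanSpace ℝ (Fin m)) E → ℝ) (a : ℝ)
    (c : LocalCoordinates n m M E) (z : ProlongationSection n m) : ProlongationSection n m :=
  ∑ α, mulFun (fun p => z.1 p α) (mulFun (fun p => -(c.read F p / a)) (frameV α))
    + ∑ α, mulFun (fun p => z.2 p α + ∑ β, z.1 p β * A.connection F c β α p)
        (mulFun (fun p => a / c.read F p) (A.delta F c α))

/-- Integrability of the almost complex structure: its Nijenhuis tensor vanishes on `E ∖ {0}`. -/
def IsIntegrable (A : LieAlgebroid n m M E)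
    (F : Bundle.TotalSpace (EuclideanSpace ℝ (Fin m)) E → ℝ) (a : ℝ) : Prop :=
  ∀ (c : LocalCoordinates n m M E) (z w : ProlongationSection n m),
    z.SmoothOn c.domain → w.SmoothOn c.domain → ∀ p ∈ c.domain,
      (A.nijenhuis c (A.almostComplex F a c) z w).1 p = 0 ∧
      (A.nijenhuis c (A.almostComplex F a c) z w).2 p = 0

end LieAlgebroid

end

/-! Everything is computed in the adapted frame `δ_α, 𝒱_α`, where a section has horizontal
components `z.1` and vertical components `vert z`, and the almost complex structure only exchanges
them with factors `a/F` and `-F/a`. The bracket in this frame involves derivatives of components,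
the structure functions `L`, the curvature `ℛ`, and the vertical derivatives `∂𝒩_α^γ/∂y^β`.

In the Nijenhuis tensor the derivatives of components cancel by tensoriality. The terms in `L` and
`∂𝒩/∂y` cancel because the canonical connection is torsion free (`partialY_connection_sub`): `L` is
exactly the antisymmetrization of `∂𝒩/∂y`. What survives, in `nijenhuis_fst_eq` and
`vert_nijenhuis_eq`, is the curvature together with the derivatives of `F` that come from the
factors `a/F` and `F/a`.

On the pair `δ_α, δ_β` the vertical part compares `ℛ` with `(F/a²) ∂F/∂y`, while the horizontal part
contains only `δ_α(F)` and `δ_β(F)`. Euler's relation gives `y_α = F ∂F/∂y^α` (`lowerY_eq`), and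
`δ_α(F²) = 2F δ_α(F)` with `F > 0` (`read_pos`), so these are the two stated conditions. Conversely,
inserting the conditions into the two formulas for arbitrary sections makes all terms cancel. -/

noncomputable section

/-! ### Smooth dependence of determinants and inverse matrices -/

section SmoothMatrix

variable {X : Type*} [NormedAddCommGroup X] [NormedSpace ℝ X] {m : ℕ} {k : ℕ∞ω}

theorem contDiffAt_matrix_det {A : X → Matrix (Fin m) (Fin m) ℝ} {p : X}
    (hA : ∀ i j, ContDiffAt ℝ k (fun q => A q i j) p) :
    ContDiffAt ℝ k (fun q => (A q).det) p := by
  simp only [Matrix.det_apply]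
  refine ContDiffAt.sum fun σ _ => ContDiffAt.const_smul _ ?_
  exact contDiffAt_prod fun i _ => hA _ _

/-- Cramer's rule: each entry of the inverse is a determinant with one row replaced by a constant
one, divided by the determinant. It is used for `g^{εβ}` and for changes of frame. -/
theorem contDiffAt_matrix_inv {A : X → Matrix (Fin m) (Fin m) ℝ} {p : X}
    (hA : ∀ i j, ContDiffAt ℝ k (fun q => A q i j) p) (hp : (A p).det ≠ 0) (i j : Fin m) :
    ContDiffAt ℝ k (fun q => (A q)⁻¹ i j) p := by
  simp only [Matrix.inv_def, Ring.inverse_eq_inv', Matrix.smul_apply, smul_eq_mul,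
    Matrix.adjugate_apply]
  refine ((contDiffAt_matrix_det hA).inv hp).mul (contDiffAt_matrix_det fun r s => ?_)
  by_cases h : r = j
  · subst h; simpa using contDiffAt_const
  · simpa [Matrix.updateRow_ne h] using hA r s

end SmoothMatrix

/-! ### Partial derivatives in coordinates and Euler's relations -/

section Coordinates

variable {n m : ℕ}

theorem contDiffAt_partialX {f : Coord n m → ℝ} {p : Coord n m} (hf : ContDiffAt ℝ ∞ f p)
    (i : Fin n) : ContDiffAt ℝ ∞ (partialX i f) p :=
  (hf.fderiv_right (m := ∞) (by simp)).clm_apply contDiffAt_const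

theorem contDiffAt_partialY {f : Coord n m → ℝ} {p : Coord n m} (hf : ContDiffAt ℝ ∞ f p)
    (α : Fin m) : ContDiffAt ℝ ∞ (partialY α f) p :=
  (hf.fderiv_right (m := ∞) (by simp)).clm_apply contDiffAt_const

theorem ContDiffAt.differentiableAt_infty {X Y : Type*} [NormedAddCommGroup X] [NormedSpace ℝ X]
    [NormedAddCommGroup Y] [NormedSpace ℝ Y] {f : X → Y} {p : X} (hf : ContDiffAt ℝ ∞ f p) :
    DifferentiableAt ℝ f p :=
  hf.differentiableAt (by simp)

theorem partialY_comm {f : Coord n m → ℝ} {p : Coord n m} (hf : ContDiffAt ℝ ∞ f p)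
    (α β : Fin m) : partialY α (partialY β f) p = partialY β (partialY α f) p := by
  have h : DifferentiableAt ℝ (fderiv ℝ f) p :=
    (hf.fderiv_right (m := ∞) (by simp)).differentiableAt_infty
  have key : ∀ v w : Coord n m, fderiv ℝ (fun q => fderiv ℝ f q v) p w =
      fderiv ℝ (fderiv ℝ f) p w v := fun v w => by
    rw [fderiv_clm_apply h (differentiableAt_const v)]; simp
  have hs : IsSymmSndFDerivAt ℝ f p := hf.isSymmSndFDerivAt (by simpa using WithTop.coe_le_coe.2 (le_top : (2 : ℕ∞) ≤ ⊤))
  change fderiv ℝ (fun q => fderiv ℝ f q _) p _ = fderiv ℝ (fun q => fderiv ℝ f q _) p _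
  rw [key, key]
  exact hs _ _

theorem fderiv_vertical {f : Coord n m → ℝ} {p : Coord n m} (y : Fin m → ℝ) :
    fderiv ℝ f p (0, y) = ∑ β, y β * partialY β f p := by
  have : ((0, y) : Coord n m) = ∑ β, y β • (0, Pi.single β 1) := by
    ext i
    · simp [Prod.fst_sum]
    · simp [Prod.snd_sum, Finset.sum_apply, Pi.single_apply]
  rw [this, map_sum]
  simp only [map_smul, smul_eq_mul, partialY]

/-- Euler's relation for functions which are positively homogeneous of degree two along the
fibre. -/
theorem sum_mul_partialY_of_homogeneous {G : Coord n m → ℝ} {p : Coord n m}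
    (hG : DifferentiableAt ℝ G p)
    (hom : ∀ r : ℝ, 0 < r → G (p.1, r • p.2) = r ^ 2 * G p) :
    ∑ β, p.2 β * partialY β G p = 2 * G p := by
  rw [← fderiv_vertical]
  -- Both sides of the homogeneity identity are differentiated in `r` at `r = 1`; the identity is
  -- known only for `r > 0`, which suffices near 1.
  have h1 : HasDerivAt (fun r : ℝ => ((p.1, r • p.2) : Coord n m)) (0, p.2) 1 := by
    have := (hasDerivAt_const (1 : ℝ) p.1).prodMk ((hasDerivAt_id (1 : ℝ)).smul_const p.2)
    simpa using this
  have h2 : HasDerivAt (fun r : ℝ => G (p.1, r • p.2)) (fderiv ℝ G p (0, p.2)) 1 :=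
    HasFDerivAt.comp_hasDerivAt_of_eq (1 : ℝ) hG.hasFDerivAt h1 (by simp)
  have h3 : HasDerivAt (fun r : ℝ => r ^ 2 * G p) (2 * G p) 1 := by
    simpa using ((hasDerivAt_id (1 : ℝ)).pow 2).mul_const (G p)
  refine h2.unique (h3.congr_of_eventuallyEq ?_)
  filter_upwards [lt_mem_nhds (zero_lt_one : (0 : ℝ) < 1)] with r hr using hom r hr

theorem partialY_sum {ι : Type*} (s : Finset ι) {f : ι → Coord n m → ℝ} {p : Coord n m}
    (hf : ∀ i ∈ s, DifferentiableAt ℝ (f i) p) (α : Fin m) :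
    partialY α (fun q => ∑ i ∈ s, f i q) p = ∑ i ∈ s, partialY α (f i) p := by
  simp only [partialY]
  rw [fderiv_fun_sum hf]
  simp

theorem partialY_mul {f g : Coord n m → ℝ} {p : Coord n m} (hf : DifferentiableAt ℝ f p)
    (hg : DifferentiableAt ℝ g p) (α : Fin m) :
    partialY α (fun q => f q * g q) p = f p * partialY α g p + g p * partialY α f p := by
  simp only [partialY]
  rw [fderiv_fun_mul hf hg]
  simp

theorem partialY_snd (α β : Fin m) (p : Coord n m) :
    partialY α (fun q : Coord n m => q.2 β) p = if β = α then 1 else 0 := by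
  have : HasFDerivAt (fun q : Coord n m => q.2 β)
      ((ContinuousLinearMap.proj β).comp (ContinuousLinearMap.snd ℝ _ _)) p :=
    ((ContinuousLinearMap.proj (R := ℝ) (φ := fun _ : Fin m => ℝ) β).hasFDerivAt).comp p
      hasFDerivAt_snd
  simp [partialY, this.fderiv, Pi.single_apply]

theorem partialY_comp_fst (α : Fin m) {h : EuclideanSpace ℝ (Fin n) → ℝ} {p : Coord n m}
    (hh : DifferentiableAt ℝ h p.1) : partialY α (fun q : Coord n m => h q.1) p = 0 := by
  have : HasFDerivAt (fun q : Coord n m => h q.1)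
      ((fderiv ℝ h p.1).comp (ContinuousLinearMap.fst ℝ _ _)) p :=
    hh.hasFDerivAt.comp p hasFDerivAt_fst
  simp [partialY, this.fderiv]

/-- A second Euler relation, obtained by differentiating the first along the fibre. -/
theorem sum_partialY_partialY_of_homogeneous {G : Coord n m → ℝ} {p : Coord n m}
    (hG : ContDiffAt ℝ ∞ G p)
    (hom : ∀ᶠ q in nhds p, ∀ r : ℝ, 0 < r → G (q.1, r • q.2) = r ^ 2 * G q) (α : Fin m) :
    ∑ β, partialY α (partialY β G) p * p.2 β = partialY α G p := by
  -- The first Euler relation is needed on a neighbourhood, since it is about to be differentiated.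
  -- Differentiating the factor `y^β` produces one copy of `∂G/∂y^α`, leaving `2 - 1` of them.
  have hd : ∀ᶠ q in nhds p, ∑ β, q.2 β * partialY β G q = 2 * G q := by
    have h1 : ContDiffAt ℝ 1 G p := hG.of_le (by exact_mod_cast le_top)
    filter_upwards [hom, h1.eventually (by simp)] with q hq hq'
    exact sum_mul_partialY_of_homogeneous (hq'.differentiableAt (by simp)) hq
  have hy : ∀ β, DifferentiableAt ℝ (fun q : Coord n m => q.2 β) p := fun β => by fun_prop
  have hP : ∀ β, DifferentiableAt ℝ (partialY β G) p := fun β =>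
    (contDiffAt_partialY hG β).differentiableAt_infty
  have h1 : partialY α (fun q => ∑ β, q.2 β * partialY β G q) p =
      partialY α (fun q => 2 * G q) p := by
    have h2 := Filter.EventuallyEq.fderiv_eq (𝕜 := ℝ) hd
    unfold partialY at h2 ⊢
    rw [h2]
  rw [partialY_sum (f := fun β q => q.2 β * partialY β G q) _ fun β _ => (hy β).mul (hP β),
    partialY_mul (differentiableAt_const _) hG.differentiableAt_infty] at h1
  simp only [partialY_mul (hy _) (hP _), partialY_snd, Finset.sum_add_distrib] at h1
  have h2 : partialY α (fun _ : Coord n m => (2 : ℝ)) p = 0 := by simp [partialY]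
  rw [h2] at h1
  simp only [mul_ite, mul_one, mul_zero, Finset.sum_ite_eq', Finset.mem_univ, if_true] at h1
  calc _ = ∑ β, p.2 β * partialY α (partialY β G) p := Finset.sum_congr rfl fun _ _ => mul_comm _ _
    _ = _ := by linarith

end Coordinates

/-! ### Smoothness of coordinate expressions and structure functions -/

section Smoothness

variable {n m : ℕ} {M : Type*} [TopologicalSpace M]
  [ChartedSpace (EuclideanSpace ℝ (Fin n)) M] [IsManifold (𝓡 n) ∞ M]
  {E : M → Type*} [∀ x, AddCommGroup (E x)] [∀ x, Module ℝ (E x)]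
  [∀ x, TopologicalSpace (E x)]
  [TopologicalSpace (Bundle.TotalSpace (EuclideanSpace ℝ (Fin m)) E)]
  [FiberBundle (EuclideanSpace ℝ (Fin m)) E]

namespace LocalCoordinates

theorem isOpen_domain (c : LocalCoordinates n m M E) : IsOpen c.domain :=
  (c.chart.open_target.preimage continuous_fst).inter
    (isOpen_ne.preimage continuous_snd)

theorem contMDiffAt_chart_symm (c : LocalCoordinates n m M E) {x : EuclideanSpace ℝ (Fin n)}
    (hx : x ∈ c.chart.target) : ContMDiffAt (𝓡 n) (𝓡 n) ∞ c.chart.symm x :=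
  contMDiffAt_symm_of_mem_maximalAtlas c.chart_mem hx

/-- Linear independence of the frame; this places coordinate points where `F` is smooth. -/
theorem point_ne_zero (c : LocalCoordinates n m M E) {p : Coord n m} (hp : p ∈ c.domain) :
    (c.point p).2 ≠ 0 := by
  intro h
  have hx := c.chart.map_target hp.1
  exact hp.2 (funext (Fintype.linearIndependent_iff.1 (c.isFrame.linearIndependent hx) p.2 h))

theorem read_smul (c : LocalCoordinates n m M E)
    {F : Bundle.TotalSpace (EuclideanSpace ℝ (Fin m)) E → ℝ} (hF : IsFinslerFunction n F)
    (p : Coord n m) {r : ℝ} (hr : 0 < r) : c.read F (p.1, r • p.2) = r * c.read F p := by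
  have := hF.homogeneous (c.chart.symm p.1) (∑ α, p.2 α • c.frame α (c.chart.symm p.1)) r hr
  simpa only [read, point, Pi.smul_apply, smul_eq_mul, mul_smul, Finset.smul_sum] using this

/-- A smooth section read in a trivialization of the bundle and a chart of the base. -/
theorem contDiffAt_trivialization_section (c : LocalCoordinates n m M E)
    (s : Cₛ^∞⟮𝓡 n; EuclideanSpace ℝ (Fin m), E⟯) {x : EuclideanSpace ℝ (Fin n)}
    (hx : x ∈ c.chart.target) :
    ContDiffAt ℝ ∞ (fun x' => (trivializationAt (EuclideanSpace ℝ (Fin m)) E (c.chart.symm x)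
      ⟨c.chart.symm x', s (c.chart.symm x')⟩).2) x := by
  have h := (Bundle.contMDiffAt_section (c.chart.symm x)).1 (s.contMDiff (c.chart.symm x))
  exact (h.comp x (c.contMDiffAt_chart_symm hx)).contDiffAt

theorem eventually_mem_baseSet (c : LocalCoordinates n m M E) {x : EuclideanSpace ℝ (Fin n)}
    (hx : x ∈ c.chart.target) : ∀ᶠ x' in nhds x, c.chart.symm x' ∈
      (trivializationAt (EuclideanSpace ℝ (Fin m)) E (c.chart.symm x)).baseSet :=
  (c.contMDiffAt_chart_symm hx).continuousAt.eventually
    ((trivializationAt (EuclideanSpace ℝ (Fin m)) E (c.chart.symm x)).open_baseSet.mem_nhds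
      (FiberBundle.mem_baseSet_trivializationAt' _))

variable [VectorBundle ℝ (EuclideanSpace ℝ (Fin m)) E]

theorem trivialization_sum {ι : Type*} (t : Finset ι)
    (e : Bundle.Trivialization (EuclideanSpace ℝ (Fin m))
      (Bundle.TotalSpace.proj : Bundle.TotalSpace (EuclideanSpace ℝ (Fin m)) E → M))
    [MemTrivializationAtlas e] {b : M} (hb : b ∈ e.baseSet) (y : ι → ℝ) (v : ι → E b) :
    (e ⟨b, ∑ α ∈ t, y α • v α⟩).2 = ∑ α ∈ t, y α • (e ⟨b, v α⟩).2 := by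
  have h : ∀ w : E b, (e ⟨b, w⟩).2 = e.linearMapAt ℝ b w := fun w => by
    rw [Bundle.Trivialization.linearMapAt_apply, if_pos hb]
  simp only [h, map_sum, map_smul]

/-- By linearity of a trivialization on fibres, the fibre component is `∑ y^α` times the trivialized
frame sections, and these are smooth in `x`. -/
theorem contMDiffAt_point (c : LocalCoordinates n m M E) {p : Coord n m}
    (hp : p.1 ∈ c.chart.target) :
    ContMDiffAt 𝓘(ℝ, Coord n m) ((𝓡 n).prod 𝓘(ℝ, EuclideanSpace ℝ (Fin m))) ∞ c.point p := by
  have hfst : ContMDiffAt 𝓘(ℝ, Coord n m) (𝓡 n) ∞ (fun q : Coord n m => q.1) p :=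
    contDiffAt_fst.contMDiffAt
  rw [Bundle.contMDiffAt_totalSpace]
  refine ⟨(c.contMDiffAt_chart_symm hp).comp p hfst, ContDiffAt.contMDiffAt ?_⟩
  have hy : ∀ α, ContDiffAt ℝ ∞ (fun q : Coord n m => q.2 α) p := fun α => by fun_prop
  have h : ContDiffAt ℝ ∞ (fun q : Coord n m => ∑ α, q.2 α •
      (trivializationAt (EuclideanSpace ℝ (Fin m)) E (c.chart.symm p.1)
        ⟨c.chart.symm q.1, c.frame α (c.chart.symm q.1)⟩).2) p :=
    ContDiffAt.sum fun α _ => ContDiffAt.smul (hy α)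
      ((c.contDiffAt_trivialization_section (c.frame α) hp).comp p contDiffAt_fst)
  refine h.congr_of_eventuallyEq ?_
  filter_upwards [continuous_fst.continuousAt.eventually (c.eventually_mem_baseSet hp)] with q hq
  exact trivialization_sum Finset.univ _ hq q.2 _

theorem contDiffAt_read (c : LocalCoordinates n m M E)
    {F : Bundle.TotalSpace (EuclideanSpace ℝ (Fin m)) E → ℝ} (hF : IsFinslerFunction n F)
    {p : Coord n m} (hp : p ∈ c.domain) : ContDiffAt ℝ ∞ (c.read F) p := by
  have h1 : ContMDiffOn 𝓘(ℝ, Coord n m) ((𝓡 n).prod 𝓘(ℝ, EuclideanSpace ℝ (Fin m))) ∞ c.point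
      c.domain := fun q hq => (c.contMDiffAt_point hq.1).contMDiffWithinAt
  have h2 := hF.smooth.comp h1 fun q hq => c.point_ne_zero hq
  exact (h2.contMDiffAt (c.isOpen_domain.mem_nhds hp)).contDiffAt

/-- In a trivialization the coefficients solve a linear system whose matrix `B` has the frame as
columns and whose right-hand side is the section. Both are smooth and `B` is invertible, so the
solution `B⁻¹ b` is smooth. -/
theorem contDiffAt_coeff (c : LocalCoordinates n m M E)
    (s : Cₛ^∞⟮𝓡 n; EuclideanSpace ℝ (Fin m), E⟯) {x : EuclideanSpace ℝ (Fin n)}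
    (hx : x ∈ c.chart.target) (γ : Fin m) :
    ContDiffAt ℝ ∞ (fun x' => c.isFrame.coeff γ (c.chart.symm x') (s (c.chart.symm x'))) x := by
  set e := trivializationAt (EuclideanSpace ℝ (Fin m)) E (c.chart.symm x) with he
  let B : EuclideanSpace ℝ (Fin n) → Matrix (Fin m) (Fin m) ℝ := fun x' =>
    Matrix.of fun i β => (e ⟨c.chart.symm x', c.frame β (c.chart.symm x')⟩).2 i
  let b : EuclideanSpace ℝ (Fin n) → Fin m → ℝ := fun x' i =>
    (e ⟨c.chart.symm x', s (c.chart.symm x')⟩).2 i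
  have happ : ∀ i, ContDiff ℝ ∞ (fun v : EuclideanSpace ℝ (Fin m) => v i) := fun i => by fun_prop
  have hB : ∀ i β, ContDiffAt ℝ ∞ (fun x' => B x' i β) x := fun i β =>
    (happ i).contDiffAt.comp x (c.contDiffAt_trivialization_section (c.frame β) hx)
  have hb : ∀ i, ContDiffAt ℝ ∞ (fun x' => b x' i) x := fun i =>
    (happ i).contDiffAt.comp x (c.contDiffAt_trivialization_section s hx)
  -- A nonzero kernel vector of `B x` would be a linear relation between the frame vectors at the
  -- point.
  have hdet : (B x).det ≠ 0 := by
    have hxb : c.chart.symm x ∈ e.baseSet := FiberBundle.mem_baseSet_trivializationAt' _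
    have hli := c.isFrame.linearIndependent (c.chart.map_target hx)
    intro h0
    obtain ⟨v, hv0, hv⟩ := Matrix.exists_mulVec_eq_zero_iff.2 h0
    refine hv0 (funext (Fintype.linearIndependent_iff.1 hli v ?_))
    have h1 : (e ⟨c.chart.symm x, ∑ α, v α • c.frame α (c.chart.symm x)⟩).2 = 0 := by
      rw [trivialization_sum _ _ hxb]
      ext i
      have := congrFun hv i
      simp only [Matrix.mulVec, dotProduct, B, Matrix.of_apply, Pi.zero_apply] at this
      simpa [mul_comm] using this
    have h2 := (e.linearEquivAt ℝ _ hxb).map_eq_zero_iff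
      (x := ∑ α, v α • c.frame α (c.chart.symm x))
    exact h2.1 h1
  have hev : ∀ᶠ x' in nhds x,
      c.isFrame.coeff γ (c.chart.symm x') (s (c.chart.symm x')) =
        ∑ i, (B x')⁻¹ γ i * b x' i := by
    have hne : ∀ᶠ x' in nhds x, (B x').det ≠ 0 :=
      (contDiffAt_matrix_det hB).continuousAt.eventually_ne hdet
    filter_upwards [c.eventually_mem_baseSet hx, c.chart.open_target.mem_nhds hx, hne]
      with x' hx' hxt hd
    have hs := c.isFrame.coeff_sum_eq s (c.chart.map_target hxt)
    have : b x' = (B x').mulVec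
        (fun β => c.isFrame.coeff β (c.chart.symm x') (s (c.chart.symm x'))) := by
      funext i
      change (e ⟨c.chart.symm x', s (c.chart.symm x')⟩).2 i = _
      rw [hs, trivialization_sum _ _ hx']
      simp only [Matrix.mulVec, dotProduct, B, Matrix.of_apply, ← hs]
      simp [mul_comm, he]
    have h3 := congrArg ((B x')⁻¹.mulVec) this
    rw [Matrix.mulVec_mulVec, Matrix.nonsing_inv_mul _ (isUnit_iff_ne_zero.2 hd),
      Matrix.one_mulVec] at h3
    exact (congrFun h3 γ).symm
  exact ContDiffAt.congr_of_eventuallyEq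
    (ContDiffAt.sum fun i _ => (contDiffAt_matrix_inv hB hdet γ i).mul (hb i)) hev

end LocalCoordinates

namespace LieAlgebroid

variable [VectorBundle ℝ (EuclideanSpace ℝ (Fin m)) E]
  [ContMDiffVectorBundle ∞ (EuclideanSpace ℝ (Fin m)) E (𝓡 n)]

theorem contDiffAt_structL (A : LieAlgebroid n m M E) (c : LocalCoordinates n m M E)
    (α β γ : Fin m) {x : EuclideanSpace ℝ (Fin n)} (hx : x ∈ c.chart.target) :
    ContDiffAt ℝ ∞ (A.structL c α β γ) x :=
  c.contDiffAt_coeff _ hx γ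

theorem bracket_swap (A : LieAlgebroid n m M E)
    (s t : Cₛ^∞⟮𝓡 n; EuclideanSpace ℝ (Fin m), E⟯) : A.bracket t s = -A.bracket s t := by
  have h := A.bracket_self (s + t)
  -- Polarization of `[s + t, s + t] = 0`.
  simp only [map_add, LinearMap.add_apply, A.bracket_self, zero_add, add_zero] at h
  exact (neg_eq_of_add_eq_zero_left h).symm

theorem structL_swap (A : LieAlgebroid n m M E) (c : LocalCoordinates n m M E)
    (α β γ : Fin m) (x : EuclideanSpace ℝ (Fin n)) :
    A.structL c β α γ x = -A.structL c α β γ x := by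
  simp only [structL]
  rw [A.bracket_swap (c.frame α) (c.frame β), ContMDiffSection.coe_neg, Pi.neg_apply, map_neg]

/-- The vector `σ_α` is the tangent map of the chart applied to the smooth curve of data anchor ∘
frame ∘ inverse chart; on the open chart domain the derivative within the domain is the full
derivative. -/
theorem contDiffAt_structSigma (A : LieAlgebroid n m M E) (c : LocalCoordinates n m M E)
    (α : Fin m) (i : Fin n) {x : EuclideanSpace ℝ (Fin n)} (hx : x ∈ c.chart.target) :
    ContDiffAt ℝ ∞ (A.structSigma c α i) x := by
  have happ : ContDiff ℝ ∞ (fun v : EuclideanSpace ℝ (Fin n) => v i) := by fun_prop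
  have h1 : ContMDiffAt (𝓡 n) (𝓡 n).tangent ∞ (fun x' => (⟨c.chart.symm x',
      A.anchor (c.chart.symm x') (c.frame α (c.chart.symm x'))⟩ : TangentBundle (𝓡 n) M)) x :=
    ((A.anchor_smooth.comp (c.frame α).contMDiff).contMDiffAt).comp x
      (c.contMDiffAt_chart_symm hx)
  have h2 := (contMDiffOn_of_mem_maximalAtlas c.chart_mem).contMDiffOn_tangentMapWithin
    (m := ∞) (by simp) c.chart.open_source.uniqueMDiffOn
  have h3 := (h2.contMDiffAt ((c.chart.open_source.preimage
    (FiberBundle.continuous_proj _ _)).mem_nhds (c.chart.map_target hx))).comp x h1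
  have h4 := ((contMDiff_snd_tangentBundle_modelSpace _ (𝓡 n)).contMDiffAt.comp x h3).contDiffAt
  refine (happ.contDiffAt.comp x h4).congr_of_eventuallyEq ?_
  filter_upwards [c.chart.open_target.mem_nhds hx] with x' hx'
  simp only [structSigma, Function.comp, tangentMapWithin]
  rw [mfderivWithin_of_isOpen c.chart.open_source (c.chart.map_target hx')]

end LieAlgebroid
end Smoothness

/-! ### Consequences of the Finsler axioms; torsion of the canonical connection -/

section Finsler

variable {n m : ℕ} {M : Type*} [TopologicalSpace M]
  [ChartedSpace (EuclideanSpace ℝ (Fin n)) M] [IsManifold (𝓡 n) ∞ M]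
  {E : M → Type*} [∀ x, AddCommGroup (E x)] [∀ x, Module ℝ (E x)]
  [∀ x, TopologicalSpace (E x)]
  [TopologicalSpace (Bundle.TotalSpace (EuclideanSpace ℝ (Fin m)) E)]
  [FiberBundle (EuclideanSpace ℝ (Fin m)) E] [VectorBundle ℝ (EuclideanSpace ℝ (Fin m)) E]
  {F : Bundle.TotalSpace (EuclideanSpace ℝ (Fin m)) E → ℝ}

namespace LocalCoordinates

theorem contDiffAt_metric (c : LocalCoordinates n m M E) (hF : IsFinslerFunction n F)
    {p : Coord n m} (hp : p ∈ c.domain) (α β : Fin m) :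
    ContDiffAt ℝ ∞ (fun q => c.metric F q α β) p :=
  contDiffAt_const.mul
    (contDiffAt_partialY (contDiffAt_partialY ((c.contDiffAt_read hF hp).pow 2) β) α)

theorem contDiffAt_lagrangian (c : LocalCoordinates n m M E) (hF : IsFinslerFunction n F)
    {p : Coord n m} (hp : p ∈ c.domain) : ContDiffAt ℝ ∞ (c.lagrangian F) p :=
  contDiffAt_const.mul ((c.contDiffAt_read hF hp).pow 2)

theorem lowerY_eq_partialY_sq (c : LocalCoordinates n m M E) (hF : IsFinslerFunction n F)
    {p : Coord n m} (hp : p ∈ c.domain) (α : Fin m) :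
    c.lowerY F α p = (1 / 2 : ℝ) * partialY α (fun q => c.read F q ^ 2) p := by
  rw [← sum_partialY_partialY_of_homogeneous ((c.contDiffAt_read hF hp).pow 2)
    (Filter.Eventually.of_forall fun q r hr => by rw [c.read_smul hF q hr]; ring) α,
    Finset.mul_sum]
  simp only [lowerY, metric, Matrix.of_apply, mul_assoc]

/-- The second Euler relation for `F²` gives `y_α = ½ ∂F²/∂y^α`. In this form the curvature
condition can be compared with the derivatives of `F` in the Nijenhuis tensor. -/
theorem lowerY_eq (c : LocalCoordinates n m M E) (hF : IsFinslerFunction n F)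
    {p : Coord n m} (hp : p ∈ c.domain) (α : Fin m) :
    c.lowerY F α p = c.read F p * partialY α (c.read F) p := by
  have hd := (c.contDiffAt_read hF hp).differentiableAt_infty
  have h := partialY_mul hd hd α
  rw [c.lowerY_eq_partialY_sq hF hp]
  simp only [pow_two]
  rw [h]; ring

/-- Applying Euler's relation twice gives `g_{αβ} y^α y^β = F²`, so positive definiteness excludes
zeros of `F` off the zero section. -/
theorem read_pos (c : LocalCoordinates n m M E) (hF : IsFinslerFunction n F)
    {p : Coord n m} (hp : p ∈ c.domain) : 0 < c.read F p := by
  have h := (hF.posDef c p hp).dotProduct_mulVec_pos hp.2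
  have h2 : star p.2 ⬝ᵥ (c.metric F p).mulVec p.2 = c.read F p ^ 2 := by
    have h3 := sum_mul_partialY_of_homogeneous (p := p) (G := fun q => c.read F q ^ 2)
      ((c.contDiffAt_read hF hp).pow 2).differentiableAt_infty
      fun r hr => by rw [c.read_smul hF p hr]; ring
    have h4 : ∀ α, (c.metric F p).mulVec p.2 α = c.lowerY F α p := fun α => rfl
    simp only [dotProduct, h4, c.lowerY_eq_partialY_sq hF hp, star_trivial]
    calc _ = (1 / 2 : ℝ) * ∑ α, p.2 α * partialY α (fun q => c.read F q ^ 2) p := by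
          rw [Finset.mul_sum]; exact Finset.sum_congr rfl fun _ _ => by ring
      _ = _ := by rw [h3]; ring
  rw [h2] at h
  exact lt_of_le_of_ne (hF.nonneg _) fun h0 => by simp [← h0] at h

end LocalCoordinates

namespace LieAlgebroid

variable [ContMDiffVectorBundle ∞ (EuclideanSpace ℝ (Fin m)) E (𝓡 n)]

theorem contDiffAt_spray (A : LieAlgebroid n m M E) (hF : IsFinslerFunction n F)
    (c : LocalCoordinates n m M E) {p : Coord n m} (hp : p ∈ c.domain) (ε : Fin m) :
    ContDiffAt ℝ ∞ (A.spray F c ε) p := by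
  have hL := c.contDiffAt_lagrangian hF hp
  have hσ : ∀ α i, ContDiffAt ℝ ∞ (fun q : Coord n m => A.structSigma c α i q.1) p :=
    fun α i => (A.contDiffAt_structSigma c α i hp.1).comp p contDiffAt_fst
  have hl : ∀ α β γ, ContDiffAt ℝ ∞ (fun q : Coord n m => A.structL c α β γ q.1) p :=
    fun α β γ => (A.contDiffAt_structL c α β γ hp.1).comp p contDiffAt_fst
  have hy : ∀ α, ContDiffAt ℝ ∞ (fun q : Coord n m => q.2 α) p := fun α => by fun_prop
  refine ContDiffAt.sum fun β _ => ContDiffAt.mul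
    (contDiffAt_matrix_inv (c.contDiffAt_metric hF hp) (hF.posDef c p hp).det_pos.ne' ε β) ?_
  refine ((ContDiffAt.sum fun i _ => (hσ β i).mul (contDiffAt_partialX hL i)).sub
    (ContDiffAt.sum fun α _ => ContDiffAt.sum fun i _ => ((hσ α i).mul (hy α)).mul
      (contDiffAt_partialX (contDiffAt_partialY hL β) i))).sub
    (ContDiffAt.sum fun α _ => ContDiffAt.sum fun θ _ => ((hl β α θ).mul (hy α)).mul
      (contDiffAt_partialY hL θ))

theorem contDiffAt_connection (A : LieAlgebroid n m M E) (hF : IsFinslerFunction n F)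
    (c : LocalCoordinates n m M E) {p : Coord n m} (hp : p ∈ c.domain) (α β : Fin m) :
    ContDiffAt ℝ ∞ (A.connection F c α β) p := by
  have hy : ∀ α, ContDiffAt ℝ ∞ (fun q : Coord n m => q.2 α) p := fun α => by fun_prop
  exact contDiffAt_const.mul ((contDiffAt_partialY (A.contDiffAt_spray hF c hp β) α).neg.add
    (ContDiffAt.sum fun ε _ => (hy ε).mul
      ((A.contDiffAt_structL c α ε β hp.1).comp p contDiffAt_fst)))

/-- The canonical nonlinear connection is torsion free. -/
theorem partialY_connection_sub (A : LieAlgebroid n m M E) (hF : IsFinslerFunction n F)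
    (c : LocalCoordinates n m M E) {p : Coord n m} (hp : p ∈ c.domain) (α β γ : Fin m) :
    partialY β (A.connection F c α γ) p - partialY α (A.connection F c β γ) p =
      A.structL c α β γ p.1 := by
  -- The vertical derivative of `𝒩` is half a Hessian of the spray, symmetric in the lower indices,
  -- plus half of `L`, antisymmetric in them. Only the latter survives the difference.
  have key : ∀ α β, partialY β (A.connection F c α γ) p =
      (1 / 2 : ℝ) * (-partialY β (partialY α (A.spray F c γ)) p + A.structL c α β γ p.1) := by
    intro α β
    have hS := (contDiffAt_partialY (A.contDiffAt_spray hF c hp γ) α).differentiableAt_infty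
    have hl : ∀ ε, DifferentiableAt ℝ (A.structL c α ε γ) p.1 := fun ε =>
      (A.contDiffAt_structL c α ε γ hp.1).differentiableAt_infty
    have hl' : ∀ ε, DifferentiableAt ℝ (fun q : Coord n m => A.structL c α ε γ q.1) p :=
      fun ε => (hl ε).comp p differentiableAt_fst
    have hy : ∀ ε, DifferentiableAt ℝ (fun q : Coord n m => q.2 ε) p := fun ε => by fun_prop
    have h1 : partialY β (fun q : Coord n m => ∑ ε, q.2 ε * A.structL c α ε γ q.1) p =
        A.structL c α β γ p.1 := by
      rw [partialY_sum (f := fun ε q => q.2 ε * A.structL c α ε γ q.1) _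
        fun ε _ => (hy ε).mul (hl' ε)]
      simp only [partialY_mul (hy _) (hl' _), partialY_snd, partialY_comp_fst β (hl _)]
      simp
    have h2 : DifferentiableAt ℝ
        (fun q : Coord n m => ∑ ε, q.2 ε * A.structL c α ε γ q.1) p :=
      DifferentiableAt.fun_sum fun ε _ => (hy ε).mul (hl' ε)
    rw [← h1]
    unfold connection
    have h3 := partialY_mul (differentiableAt_const (1 / 2 : ℝ)) (hS.fun_neg.fun_add h2) β
    rw [h3]
    have h4 : ∀ r : ℝ, partialY β (fun _ : Coord n m => r) p = 0 := fun r => by simp [partialY]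
    rw [h4, mul_zero, add_zero]
    congr 1
    change fderiv ℝ _ p _ = -fderiv ℝ _ p _ + fderiv ℝ _ p _
    rw [fderiv_fun_add hS.fun_neg h2, fderiv_fun_neg]
    rfl
  rw [key α β, key β α, partialY_comm (A.contDiffAt_spray hF c hp γ) α β,
    A.structL_swap c α β γ]
  ring

end LieAlgebroid
end Finsler

/-! ### Contractions of bilinear coefficients -/

/-- The value `∑ x^α y^β T_{αβ}` of a bilinear form. -/
def bilinearSum {m : ℕ} (T : Fin m → Fin m → ℝ) (x y : Fin m → ℝ) : ℝ :=
  ∑ α, ∑ β, x α * y β * T α β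

section BilinearSum

variable {m : ℕ} (T : Fin m → Fin m → ℝ) (x y : Fin m → ℝ) (r : ℝ)

theorem bilinearSum_smul_left :
    bilinearSum T (fun α => r * x α) y = r * bilinearSum T x y := by
  simp only [bilinearSum, Finset.mul_sum, mul_assoc]

theorem bilinearSum_smul_right :
    bilinearSum T x (fun α => r * y α) = r * bilinearSum T x y := by
  simp only [bilinearSum, Finset.mul_sum]
  exact Finset.sum_congr rfl fun _ _ => Finset.sum_congr rfl fun _ _ => by ring

theorem bilinearSum_swap :
    bilinearSum T x y = bilinearSum (fun α β => T β α) y x := by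
  unfold bilinearSum
  rw [Finset.sum_comm]
  exact Finset.sum_congr rfl fun _ _ => Finset.sum_congr rfl fun _ _ => by ring

theorem bilinearSum_sub (T' : Fin m → Fin m → ℝ) :
    bilinearSum (fun α β => T α β - T' α β) x y = bilinearSum T x y - bilinearSum T' x y := by
  simp only [bilinearSum, mul_sub, Finset.sum_sub_distrib]

theorem bilinearSum_add (T' : Fin m → Fin m → ℝ) :
    bilinearSum (fun α β => T α β + T' α β) x y = bilinearSum T x y + bilinearSum T' x y := by
  simp only [bilinearSum, mul_add, Finset.sum_add_distrib]

theorem sum_mul_sum_eq_bilinearSum :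
    ∑ β, y β * ∑ α, x α * T α β = bilinearSum T x y := by
  unfold bilinearSum
  rw [Finset.sum_comm]
  simp only [Finset.mul_sum]
  exact Finset.sum_congr rfl fun _ _ => Finset.sum_congr rfl fun _ _ => by ring

end BilinearSum

/-! ### Calculus in the adapted frame -/

namespace LieAlgebroid

open ProlongationSection

variable {n m : ℕ} {M : Type*} [TopologicalSpace M]
  [ChartedSpace (EuclideanSpace ℝ (Fin n)) M] [IsManifold (𝓡 n) ∞ M]
  {E : M → Type*} [∀ x, AddCommGroup (E x)] [∀ x, Module ℝ (E x)]
  [∀ x, TopologicalSpace (E x)]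
  [TopologicalSpace (Bundle.TotalSpace (EuclideanSpace ℝ (Fin m)) E)]
  [FiberBundle (EuclideanSpace ℝ (Fin m)) E] [VectorBundle ℝ (EuclideanSpace ℝ (Fin m)) E]
  [ContMDiffVectorBundle ∞ (EuclideanSpace ℝ (Fin m)) E (𝓡 n)]
  (A : LieAlgebroid n m M E) (c : LocalCoordinates n m M E)
  (F : Bundle.TotalSpace (EuclideanSpace ℝ (Fin m)) E → ℝ)

/-! ### The anchor as a derivation -/

section Derivation

variable {p : Coord n m} (z : ProlongationSection n m)

theorem derivAlong_add {f g : Coord n m → ℝ} (hf : DifferentiableAt ℝ f p)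
    (hg : DifferentiableAt ℝ g p) : A.derivAlong c z (fun q => f q + g q) p =
      A.derivAlong c z f p + A.derivAlong c z g p := by
  simp only [derivAlong, partialX, partialY, fderiv_fun_add hf hg, _root_.add_apply,
    mul_add, Finset.sum_add_distrib]
  ring

theorem derivAlong_mul {f g : Coord n m → ℝ} (hf : DifferentiableAt ℝ f p)
    (hg : DifferentiableAt ℝ g p) : A.derivAlong c z (fun q => f q * g q) p =
      f p * A.derivAlong c z g p + g p * A.derivAlong c z f p := by
  simp only [derivAlong, partialX, partialY, fderiv_fun_mul hf hg, _root_.add_apply,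
    _root_.smul_apply, smul_eq_mul, mul_add, Finset.sum_add_distrib, Finset.mul_sum]
  simp only [mul_left_comm (f p), mul_left_comm (g p)]
  ring

theorem derivAlong_const (r : ℝ) : A.derivAlong c z (fun _ => r) p = 0 := by
  simp [derivAlong, partialX, partialY]

theorem derivAlong_const_mul {f : Coord n m → ℝ} (r : ℝ) (hf : DifferentiableAt ℝ f p) :
    A.derivAlong c z (fun q => r * f q) p = r * A.derivAlong c z f p := by
  rw [A.derivAlong_mul c z (differentiableAt_const r) hf, derivAlong_const]; ring

theorem derivAlong_sum {ι : Type*} (s : Finset ι) {f : ι → Coord n m → ℝ}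
    (hf : ∀ i ∈ s, DifferentiableAt ℝ (f i) p) :
    A.derivAlong c z (fun q => ∑ i ∈ s, f i q) p = ∑ i ∈ s, A.derivAlong c z (f i) p := by
  classical
  induction s using Finset.induction_on with
  | empty => simpa using A.derivAlong_const c z 0
  | insert i s his ih =>
    simp only [Finset.sum_insert his]
    rw [A.derivAlong_add c z (hf i (Finset.mem_insert_self i s))
      (DifferentiableAt.fun_sum fun j hj => hf j (Finset.mem_insert_of_mem hj)),
      ih fun j hj => hf j (Finset.mem_insert_of_mem hj)]

theorem derivAlong_const_div {f : Coord n m → ℝ} (r : ℝ) (hf : DifferentiableAt ℝ f p)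
    (hp : f p ≠ 0) :
    A.derivAlong c z (fun q => r / f q) p = -(r / f p ^ 2) * A.derivAlong c z f p := by
  have h : fderiv ℝ (fun q => r / f q) p = (-(r / f p ^ 2)) • fderiv ℝ f p := by
    have h1 := ((hasDerivAt_inv hp).comp_hasFDerivAt p hf.hasFDerivAt).const_mul r
    have h2 : HasFDerivAt (fun q => r / f q) (r • (-(f p ^ 2)⁻¹ • fderiv ℝ f p)) p := by
      simpa only [div_eq_mul_inv, Function.comp_def] using h1
    rw [h2.fderiv, smul_smul]
    congr 1; ring
  simp only [derivAlong, partialX, partialY, h, _root_.smul_apply, smul_eq_mul,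
    mul_add, Finset.mul_sum]
  simp only [mul_left_comm (-(r / f p ^ 2))]

end Derivation

/-! ### The adapted frame `δ_α, 𝒱_α` -/

/-- The vertical components of a section of `𝒯E` in the frame `δ_α, 𝒱_α`. -/
def vert (z : ProlongationSection n m) (p : Coord n m) (γ : Fin m) : ℝ :=
  z.2 p γ + ∑ β, z.1 p β * A.connection F c β γ p

theorem delta_fst (α : Fin m) (p : Coord n m) : (A.delta F c α).1 p = Pi.single α 1 := by
  simp [delta, frameX, frameV, mulFun, Prod.fst_sum]

theorem delta_snd (α : Fin m) (p : Coord n m) (γ : Fin m) :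
    (A.delta F c α).2 p γ = -A.connection F c α γ p := by
  simp [delta, frameX, frameV, mulFun, Prod.snd_sum, Finset.sum_apply, Pi.single_apply]

theorem vert_delta (α : Fin m) (p : Coord n m) (γ : Fin m) :
    A.vert c F (A.delta F c α) p γ = 0 := by
  simp [vert, delta_fst, delta_snd, Pi.single_apply]

theorem almostComplex_fst (a : ℝ) (z : ProlongationSection n m) (p : Coord n m) (γ : Fin m) :
    (A.almostComplex F a c z).1 p γ = a / c.read F p * A.vert c F z p γ := by
  simp [almostComplex, mulFun, frameV, Prod.fst_sum, Finset.sum_apply, delta_fst,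
    Pi.single_apply, vert, mul_comm]

/-- Together with `almostComplex_fst` this describes the structure in adapted components as `(Z, V)
↦ ((a/F) V, -(F/a) Z)`, which is all that later computations use. -/
theorem vert_almostComplex (a : ℝ) (z : ProlongationSection n m) (p : Coord n m) (γ : Fin m) :
    A.vert c F (A.almostComplex F a c z) p γ = -(c.read F p / a) * z.1 p γ := by
  have h : (A.almostComplex F a c z).2 p γ = -(c.read F p / a) * z.1 p γ -
      ∑ α, a / c.read F p * A.vert c F z p α * A.connection F c α γ p := by
    simp [almostComplex, mulFun, frameV, Prod.snd_sum, Finset.sum_apply, delta_snd,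
      Pi.single_apply, vert, mul_comm, sub_eq_add_neg]
    simp only [mul_assoc]
  rw [vert, h]
  simp only [almostComplex_fst]
  ring

theorem derivAlong_delta (α : Fin m) (f : Coord n m → ℝ) (p : Coord n m) :
    A.derivAlong c (A.delta F c α) f p = ∑ i, A.structSigma c α i p.1 * partialX i f p -
      ∑ β, A.connection F c α β p * partialY β f p := by
  simp only [derivAlong, delta_fst, delta_snd, Pi.single_apply, ite_mul, one_mul, zero_mul]
  rw [Finset.sum_eq_single α (fun β _ hβ => by simp [hβ]) (by simp)]
  simp [sub_eq_add_neg]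

theorem derivAlong_eq_adapted (z : ProlongationSection n m) (f : Coord n m → ℝ)
    (p : Coord n m) : A.derivAlong c z f p = ∑ α, z.1 p α * A.derivAlong c (A.delta F c α) f p +
      ∑ α, A.vert c F z p α * partialY α f p := by
  have h2 : ∑ α, z.1 p α * ∑ β, A.connection F c α β p * partialY β f p =
      ∑ β, (∑ α, z.1 p α * A.connection F c α β p) * partialY β f p := by
    simp only [Finset.mul_sum, Finset.sum_mul, mul_assoc]
    exact Finset.sum_comm
  simp only [derivAlong_delta, vert, mul_sub, add_mul, Finset.sum_sub_distrib, Finset.sum_add_distrib, h2]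
  simp only [derivAlong, Finset.mul_sum, mul_assoc]
  ring

/-- This exhibits `ℛ_{αβ}^γ` as the vertical component of `[δ_α, δ_β]`, the form in which it appears
when brackets are expanded. -/
theorem curvature_eq (α β γ : Fin m) (p : Coord n m) :
    A.curvature F c α β γ p = A.derivAlong c (A.delta F c β) (A.connection F c α γ) p -
      A.derivAlong c (A.delta F c α) (A.connection F c β γ) p +
      ∑ ε, A.structL c α β ε p.1 * A.connection F c ε γ p := by
  rw [derivAlong_delta, derivAlong_delta, curvature]
  ring

variable {A c F}

theorem differentiableAt_vert {p : Coord n m}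
    (hN : ∀ α β, DifferentiableAt ℝ (A.connection F c α β) p) {z : ProlongationSection n m}
    (hz1 : ∀ γ, DifferentiableAt ℝ (fun q => z.1 q γ) p)
    (hz2 : ∀ γ, DifferentiableAt ℝ (fun q => z.2 q γ) p) (γ : Fin m) :
    DifferentiableAt ℝ (fun q => A.vert c F z q γ) p :=
  (hz2 γ).fun_add (DifferentiableAt.fun_sum fun β _ => (hz1 β).mul (hN β γ))

/-- The vertical part of the bracket in the adapted frame. -/
theorem vert_prolongBracket {p : Coord n m}
    (hN : ∀ α β, DifferentiableAt ℝ (A.connection F c α β) p) {z w : ProlongationSection n m}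
    (hz1 : ∀ γ, DifferentiableAt ℝ (fun q => z.1 q γ) p)
    (hz2 : ∀ γ, DifferentiableAt ℝ (fun q => z.2 q γ) p)
    (hw1 : ∀ γ, DifferentiableAt ℝ (fun q => w.1 q γ) p)
    (hw2 : ∀ γ, DifferentiableAt ℝ (fun q => w.2 q γ) p) (γ : Fin m) :
    A.vert c F (A.prolongBracket c z w) p γ =
      A.derivAlong c z (fun q => A.vert c F w q γ) p -
      A.derivAlong c w (fun q => A.vert c F z q γ) p +
      bilinearSum (fun α β => A.curvature F c α β γ p) (z.1 p) (w.1 p) +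
      bilinearSum (fun α β => partialY β (A.connection F c α γ) p) (z.1 p) (A.vert c F w p) -
      bilinearSum (fun α β => partialY β (A.connection F c α γ) p) (w.1 p) (A.vert c F z p) := by
  -- The product rule applied to `vert w`, with the derivative of `𝒩` along `z` split into its `δ`
  -- and `𝒱` parts. It is stated for a general pair because it is used again with `z` and `w`
  -- exchanged; the antisymmetrized `δ(𝒩)` terms combine with the `L𝒩` term `hL` into the curvature.
  have key : ∀ {z w : ProlongationSection n m}, (∀ γ, DifferentiableAt ℝ (fun q => w.1 q γ) p) →
      (∀ γ, DifferentiableAt ℝ (fun q => w.2 q γ) p) →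
      A.derivAlong c z (fun q => A.vert c F w q γ) p =
        A.derivAlong c z (fun q => w.2 q γ) p +
        ∑ β, A.derivAlong c z (fun q => w.1 q β) p * A.connection F c β γ p +
        bilinearSum (fun α β => A.derivAlong c (A.delta F c α) (A.connection F c β γ) p)
          (z.1 p) (w.1 p) +
        bilinearSum (fun α β => partialY β (A.connection F c α γ) p) (w.1 p)
          (A.vert c F z p) := by
    intro z w hw1 hw2
    have hv : (fun q => A.vert c F w q γ) =
        fun q => w.2 q γ + ∑ β, w.1 q β * A.connection F c β γ q := rfl
    rw [hv, A.derivAlong_add c z (hw2 γ)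
        (DifferentiableAt.fun_sum fun β _ => (hw1 β).fun_mul (hN β γ)),
      A.derivAlong_sum c z (f := fun β q => w.1 q β * A.connection F c β γ q) _
        fun β _ => (hw1 β).mul (hN β γ)]
    simp only [A.derivAlong_mul c z (hw1 _) (hN _ _), Finset.sum_add_distrib]
    have h1 : ∑ β, w.1 p β * A.derivAlong c z (A.connection F c β γ) p =
        bilinearSum (fun α β => A.derivAlong c (A.delta F c α) (A.connection F c β γ) p)
          (z.1 p) (w.1 p) +
        bilinearSum (fun α β => partialY β (A.connection F c α γ) p) (w.1 p)
          (A.vert c F z p) := by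
      rw [bilinearSum_swap _ (w.1 p), ← sum_mul_sum_eq_bilinearSum,
        ← sum_mul_sum_eq_bilinearSum, ← Finset.sum_add_distrib]
      exact Finset.sum_congr rfl fun β _ => by rw [A.derivAlong_eq_adapted c F z, mul_add]
    rw [h1]
    simp only [mul_comm (A.connection F c _ γ p)]
    ring
  have hL : ∑ ε, (∑ α, ∑ β, z.1 p α * w.1 p β * A.structL c α β ε p.1) *
      A.connection F c ε γ p =
      bilinearSum (fun α β => ∑ ε, A.structL c α β ε p.1 * A.connection F c ε γ p)
        (z.1 p) (w.1 p) := by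
    simp only [bilinearSum, Finset.sum_mul, Finset.mul_sum, mul_assoc]
    rw [Finset.sum_comm]
    exact Finset.sum_congr rfl fun _ _ => Finset.sum_comm
  rw [key hw1 hw2, key hz1 hz2]
  simp only [curvature_eq, bilinearSum_add, bilinearSum_sub]
  rw [← hL, bilinearSum_swap
    (fun α β => A.derivAlong c (A.delta F c α) (A.connection F c β γ) p) (w.1 p)]
  simp only [vert, prolongBracket, add_mul, sub_mul, Finset.sum_add_distrib,
    Finset.sum_sub_distrib]
  ring

theorem vert_add (z w : ProlongationSection n m) (p : Coord n m) (γ : Fin m) :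
    A.vert c F (z + w) p γ = A.vert c F z p γ + A.vert c F w p γ := by
  simp only [vert, Prod.fst_add, Prod.snd_add, Pi.add_apply, add_mul, Finset.sum_add_distrib]
  ring

theorem vert_sub (z w : ProlongationSection n m) (p : Coord n m) (γ : Fin m) :
    A.vert c F (z - w) p γ = A.vert c F z p γ - A.vert c F w p γ := by
  simp only [vert, Prod.fst_sub, Prod.snd_sub, Pi.sub_apply, sub_mul, Finset.sum_sub_distrib]
  ring

end LieAlgebroid

/-! ### The Nijenhuis tensor in the adapted frame -/

namespace LieAlgebroid

open ProlongationSection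

variable {n m : ℕ} {M : Type*} [TopologicalSpace M]
  [ChartedSpace (EuclideanSpace ℝ (Fin n)) M] [IsManifold (𝓡 n) ∞ M]
  {E : M → Type*} [∀ x, AddCommGroup (E x)] [∀ x, Module ℝ (E x)]
  [∀ x, TopologicalSpace (E x)]
  [TopologicalSpace (Bundle.TotalSpace (EuclideanSpace ℝ (Fin m)) E)]
  [FiberBundle (EuclideanSpace ℝ (Fin m)) E] {c : LocalCoordinates n m M E}

/-- Differentiability of the components of a section at a point. -/
def DifferentiableSectionAt (z : ProlongationSection n m) (p : Coord n m) : Prop :=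
  (∀ γ, DifferentiableAt ℝ (fun q => z.1 q γ) p) ∧ ∀ γ, DifferentiableAt ℝ (fun q => z.2 q γ) p

theorem differentiableSectionAt_of_smoothOn {z : ProlongationSection n m}
    (hz : z.SmoothOn c.domain) {p : Coord n m} (hp : p ∈ c.domain) :
    DifferentiableSectionAt z p := by
  have hD := c.isOpen_domain.mem_nhds hp
  exact ⟨differentiableAt_pi.1 (hz.1.contDiffAt hD).differentiableAt_infty,
    differentiableAt_pi.1 (hz.2.contDiffAt hD).differentiableAt_infty⟩

variable [VectorBundle ℝ (EuclideanSpace ℝ (Fin m)) E]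
  [ContMDiffVectorBundle ∞ (EuclideanSpace ℝ (Fin m)) E (𝓡 n)] {A : LieAlgebroid n m M E}
  {F : Bundle.TotalSpace (EuclideanSpace ℝ (Fin m)) E → ℝ}

theorem _root_.DifferentiableAt.const_div {X : Type*} [NormedAddCommGroup X] [NormedSpace ℝ X]
    {f : X → ℝ} {p : X} (hf : DifferentiableAt ℝ f p) (a : ℝ) (hp : f p ≠ 0) :
    DifferentiableAt ℝ (fun q => a / f q) p := by
  simpa only [div_eq_mul_inv] using (hf.fun_inv hp).const_mul a

/-- The factor `a / F * (F / a)` stands for 1 and is left uncancelled because nothing is assumed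
nonzero here. -/
theorem nijenhuis_fst (a : ℝ) (z w : ProlongationSection n m) (p : Coord n m) (γ : Fin m) :
    (A.nijenhuis c (A.almostComplex F a c) z w).1 p γ =
      (A.prolongBracket c (A.almostComplex F a c z) (A.almostComplex F a c w)).1 p γ
      - a / c.read F p * A.vert c F (A.prolongBracket c (A.almostComplex F a c z) w) p γ
      - a / c.read F p * A.vert c F (A.prolongBracket c z (A.almostComplex F a c w)) p γ
      - a / c.read F p * (c.read F p / a) * (A.prolongBracket c z w).1 p γ := by
  simp only [nijenhuis, Prod.fst_add, Prod.fst_sub, Pi.add_apply, Pi.sub_apply, almostComplex_fst,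
    vert_almostComplex]
  ring

theorem vert_nijenhuis (a : ℝ) (z w : ProlongationSection n m) (p : Coord n m) (γ : Fin m) :
    A.vert c F (A.nijenhuis c (A.almostComplex F a c) z w) p γ =
      A.vert c F (A.prolongBracket c (A.almostComplex F a c z) (A.almostComplex F a c w)) p γ
      + c.read F p / a * (A.prolongBracket c (A.almostComplex F a c z) w).1 p γ
      + c.read F p / a * (A.prolongBracket c z (A.almostComplex F a c w)).1 p γ
      - a / c.read F p * (c.read F p / a) * A.vert c F (A.prolongBracket c z w) p γ := by
  simp only [nijenhuis, vert_add, vert_sub, almostComplex_fst, vert_almostComplex]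
  ring

theorem differentiableSectionAt_almostComplex {p : Coord n m} (a : ℝ)
    (hF : DifferentiableAt ℝ (c.read F) p) (hp : c.read F p ≠ 0)
    (hN : ∀ α β, DifferentiableAt ℝ (A.connection F c α β) p) {z : ProlongationSection n m}
    (hz : DifferentiableSectionAt z p) :
    DifferentiableSectionAt (A.almostComplex F a c z) p := by
  have ht : DifferentiableAt ℝ (fun q => a / c.read F q) p :=
    hF.const_div a hp
  have h1 : ∀ γ, DifferentiableAt ℝ (fun q => (A.almostComplex F a c z).1 q γ) p := fun γ => by
    simp only [almostComplex_fst]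
    exact ht.mul (differentiableAt_vert hN hz.1 hz.2 γ)
  refine ⟨h1, fun γ => ?_⟩
  -- The `𝒱`-component in the original frame is recovered from the adapted one by subtracting the
  -- contribution of `𝒩`.
  have h2 : (fun q => (A.almostComplex F a c z).2 q γ) = fun q =>
      -(1 / a) * (c.read F q * z.1 q γ) -
        ∑ β, (A.almostComplex F a c z).1 q β * A.connection F c β γ q := by
    funext q
    have h3 := A.vert_almostComplex c F a z q γ
    rw [vert] at h3
    linear_combination h3
  rw [h2]
  exact ((hF.fun_mul (hz.1 γ)).const_mul _).fun_sub
    (DifferentiableAt.fun_sum fun β _ => (h1 β).mul (hN β γ))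

theorem derivAlong_almostComplex_fst {p : Coord n m} (a : ℝ)
    (hF : DifferentiableAt ℝ (c.read F) p) (hp : c.read F p ≠ 0)
    (hN : ∀ α β, DifferentiableAt ℝ (A.connection F c α β) p) {z : ProlongationSection n m}
    (hz : DifferentiableSectionAt z p) (v : ProlongationSection n m) (γ : Fin m) :
    A.derivAlong c v (fun q => (A.almostComplex F a c z).1 q γ) p =
      a / c.read F p * A.derivAlong c v (fun q => A.vert c F z q γ) p -
      a / c.read F p ^ 2 * A.vert c F z p γ * A.derivAlong c v (c.read F) p := by
  simp only [almostComplex_fst]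
  rw [A.derivAlong_mul c v (hF.const_div a hp)
    (differentiableAt_vert hN hz.1 hz.2 γ), A.derivAlong_const_div c v a hF hp]
  ring

theorem derivAlong_vert_almostComplex {p : Coord n m} (a : ℝ)
    (hF : DifferentiableAt ℝ (c.read F) p) {z : ProlongationSection n m}
    (hz : DifferentiableSectionAt z p) (v : ProlongationSection n m) (γ : Fin m) :
    A.derivAlong c v (fun q => A.vert c F (A.almostComplex F a c z) q γ) p =
      -(c.read F p / a) * A.derivAlong c v (fun q => z.1 q γ) p -
      1 / a * z.1 p γ * A.derivAlong c v (c.read F) p := by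
  have h : (fun q => A.vert c F (A.almostComplex F a c z) q γ) =
      fun q => -(1 / a) * (c.read F q * z.1 q γ) := by
    funext q; rw [vert_almostComplex]; ring
  rw [h, A.derivAlong_const_mul c v _ (hF.fun_mul (hz.1 γ)), A.derivAlong_mul c v hF (hz.1 γ)]
  ring

section NijenhuisFormula

variable {p : Coord n m} {a : ℝ} {z w : ProlongationSection n m} (ha : a ≠ 0)
  (hF : DifferentiableAt ℝ (c.read F) p) (hp : c.read F p ≠ 0)
  (hN : ∀ α β, DifferentiableAt ℝ (A.connection F c α β) p)
  (hT : ∀ α β γ, partialY β (A.connection F c α γ) p - partialY α (A.connection F c β γ) p =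
    A.structL c α β γ p.1)
  (hz : DifferentiableSectionAt z p) (hw : DifferentiableSectionAt w p)

include hT in
-- This is where torsion-freeness enters: `L` is traded for vertical derivatives of `𝒩`, so that it
-- cancels against the terms produced by `vert_prolongBracket`.
theorem bilinearSum_structL (γ : Fin m) (x y : Fin m → ℝ) :
    bilinearSum (fun α β => A.structL c α β γ p.1) x y =
      bilinearSum (fun α β => partialY β (A.connection F c α γ) p) x y -
      bilinearSum (fun α β => partialY β (A.connection F c α γ) p) y x := by
  rw [bilinearSum_swap _ y x, ← bilinearSum_sub]
  simp only [hT]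

theorem prolongBracket_fst (γ : Fin m) : (A.prolongBracket c z w).1 p γ =
    A.derivAlong c z (fun q => w.1 q γ) p - A.derivAlong c w (fun q => z.1 q γ) p +
      bilinearSum (fun α β => A.structL c α β γ p.1) (z.1 p) (w.1 p) := rfl

include ha hF hp hN hT hz hw

/-- The horizontal part of the Nijenhuis tensor in the adapted frame. -/
theorem nijenhuis_fst_eq (γ : Fin m) :
    (A.nijenhuis c (A.almostComplex F a c) z w).1 p γ =
      -(a / c.read F p ^ 2) *
        (A.vert c F w p γ * A.derivAlong c (A.almostComplex F a c z) (c.read F) p -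
          A.vert c F z p γ * A.derivAlong c (A.almostComplex F a c w) (c.read F) p) +
      1 / c.read F p * (w.1 p γ * A.derivAlong c z (c.read F) p -
        z.1 p γ * A.derivAlong c w (c.read F) p) -
      (a / c.read F p) ^ 2 *
        (bilinearSum (fun α β => A.curvature F c α β γ p) (A.vert c F z p) (w.1 p) +
          bilinearSum (fun α β => A.curvature F c α β γ p) (z.1 p) (A.vert c F w p)) := by
  have hJz := differentiableSectionAt_almostComplex a hF hp hN hz
  have hJw := differentiableSectionAt_almostComplex a hF hp hN hw
  have e1 : ∀ u : ProlongationSection n m, (A.almostComplex F a c u).1 p =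
      fun γ => a / c.read F p * A.vert c F u p γ := fun u =>
    funext fun γ => A.almostComplex_fst c F a u p γ
  have e2 : ∀ u : ProlongationSection n m, A.vert c F (A.almostComplex F a c u) p =
      fun γ => -(c.read F p / a) * u.1 p γ := fun u =>
    funext fun γ => A.vert_almostComplex c F a u p γ
  rw [nijenhuis_fst, vert_prolongBracket hN hJz.1 hJz.2 hw.1 hw.2,
    vert_prolongBracket hN hz.1 hz.2 hJw.1 hJw.2, prolongBracket_fst, prolongBracket_fst]
  simp only [derivAlong_almostComplex_fst a hF hp hN hz, derivAlong_almostComplex_fst a hF hp hN hw,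
    derivAlong_vert_almostComplex a hF hz, derivAlong_vert_almostComplex a hF hw, e1, e2,
    bilinearSum_smul_left, bilinearSum_smul_right, bilinearSum_structL hT]
  -- All derivatives of the components of `z` and `w` and all vertical derivatives of `𝒩` cancel
  -- here.
  field_simp
  ring

/-- The vertical part of the Nijenhuis tensor in the adapted frame. -/
theorem vert_nijenhuis_eq (γ : Fin m) :
    A.vert c F (A.nijenhuis c (A.almostComplex F a c) z w) p γ =
      1 / a * (z.1 p γ * A.derivAlong c (A.almostComplex F a c w) (c.read F) p -
        w.1 p γ * A.derivAlong c (A.almostComplex F a c z) (c.read F) p) +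
      1 / c.read F p * (A.vert c F z p γ * A.derivAlong c w (c.read F) p -
        A.vert c F w p γ * A.derivAlong c z (c.read F) p) +
      (a / c.read F p) ^ 2 *
        bilinearSum (fun α β => A.curvature F c α β γ p) (A.vert c F z p) (A.vert c F w p) -
      bilinearSum (fun α β => A.curvature F c α β γ p) (z.1 p) (w.1 p) := by
  have hJz := differentiableSectionAt_almostComplex a hF hp hN hz
  have hJw := differentiableSectionAt_almostComplex a hF hp hN hw
  have e1 : ∀ u : ProlongationSection n m, (A.almostComplex F a c u).1 p =
      fun γ => a / c.read F p * A.vert c F u p γ := fun u =>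
    funext fun γ => A.almostComplex_fst c F a u p γ
  have e2 : ∀ u : ProlongationSection n m, A.vert c F (A.almostComplex F a c u) p =
      fun γ => -(c.read F p / a) * u.1 p γ := fun u =>
    funext fun γ => A.vert_almostComplex c F a u p γ
  rw [vert_nijenhuis, vert_prolongBracket hN hJz.1 hJz.2 hJw.1 hJw.2,
    vert_prolongBracket hN hz.1 hz.2 hw.1 hw.2, prolongBracket_fst, prolongBracket_fst]
  simp only [derivAlong_almostComplex_fst a hF hp hN hz, derivAlong_almostComplex_fst a hF hp hN hw,
    derivAlong_vert_almostComplex a hF hz, derivAlong_vert_almostComplex a hF hw, e1, e2,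
    bilinearSum_smul_left, bilinearSum_smul_right, bilinearSum_structL hT]
  field_simp
  ring

end NijenhuisFormula

theorem derivAlong_almostComplex (a : ℝ) (z : ProlongationSection n m) (f : Coord n m → ℝ)
    (p : Coord n m) : A.derivAlong c (A.almostComplex F a c z) f p =
      a / c.read F p * ∑ α, A.vert c F z p α * A.derivAlong c (A.delta F c α) f p -
      c.read F p / a * ∑ α, z.1 p α * partialY α f p := by
  rw [derivAlong_eq_adapted A c F]
  simp only [almostComplex_fst, vert_almostComplex, Finset.mul_sum, mul_assoc, neg_mul,
    Finset.sum_neg_distrib, sub_eq_add_neg]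

/-- Makes the horizontal frame available as test sections in `IsIntegrable`. -/
theorem contDiffOn_delta (hF : IsFinslerFunction n F) (α : Fin m) :
    (A.delta F c α).SmoothOn c.domain := by
  constructor
  · have : (A.delta F c α).1 = fun _ => Pi.single α 1 := funext fun p => A.delta_fst c F α p
    rw [this]; exact contDiffOn_const
  · rw [contDiffOn_pi]
    intro γ p hp
    simp only [delta_snd]
    exact (A.contDiffAt_connection hF c hp α γ).neg.contDiffWithinAt

theorem bilinearSum_single (T : Fin m → Fin m → ℝ) (α β : Fin m) :
    bilinearSum T (Pi.single α 1) (Pi.single β 1) = T α β := by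
  simp [bilinearSum, Pi.single_apply]

/-- The bilinear sum of `r (u_α δ_β^γ - u_β δ_α^γ)`. -/
theorem bilinearSum_wedge (r : ℝ) (u x y : Fin m → ℝ) (γ : Fin m) :
    bilinearSum (fun α β => r * (u α * (if β = γ then 1 else 0) - u β * if α = γ then 1 else 0))
      x y = r * ((∑ α, x α * u α) * y γ - (∑ β, y β * u β) * x γ) := by
  have h1 : ∑ α, ∑ β, x α * y β * (u α * if β = γ then 1 else 0) = (∑ α, x α * u α) * y γ := by
    rw [Finset.sum_mul]
    refine Finset.sum_congr rfl fun α _ => ?_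
    simp only [mul_ite, mul_one, mul_zero, Finset.sum_ite_eq', Finset.mem_univ, if_true]
    ring
  have h2 : ∑ α, ∑ β, x α * y β * (u β * if α = γ then 1 else 0) = (∑ β, y β * u β) * x γ := by
    rw [Finset.sum_comm, Finset.sum_mul]
    refine Finset.sum_congr rfl fun α _ => ?_
    simp only [mul_ite, mul_one, mul_zero, Finset.sum_ite_eq', Finset.mem_univ, if_true]
    ring
  rw [← h1, ← h2]
  simp only [bilinearSum, ← Finset.sum_sub_distrib, Finset.mul_sum]
  exact Finset.sum_congr rfl fun _ _ => Finset.sum_congr rfl fun _ _ => by ring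

/-- The passage from the coordinate frame to the adapted frame is triangular, so vanishing may be
tested in either. -/
theorem nijenhuis_eq_zero_iff {T : ProlongationSection n m} {p : Coord n m} :
    (T.1 p = 0 ∧ T.2 p = 0) ↔ ∀ γ, T.1 p γ = 0 ∧ A.vert c F T p γ = 0 := by
  constructor
  · rintro ⟨h1, h2⟩ γ
    simp [vert, h1, h2]
  · intro h
    have h1 : T.1 p = 0 := funext fun γ => (h γ).1
    refine ⟨h1, funext fun γ => ?_⟩
    simpa [vert, h1] using (h γ).2

end LieAlgebroid

end

/-! ### The equivalence -/

/-- Integrability of the homogeneity-preserving almost complex structure of a Finsler function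
on a Lie algebroid. -/
theorem theorem1p3p3 {n m : ℕ} {M : Type*} [TopologicalSpace M] [T2Space M]
    [SecondCountableTopology M]
    [ChartedSpace (EuclideanSpace ℝ (Fin n)) M] [IsManifold (𝓡 n) ∞ M]
    {E : M → Type*} [∀ x, AddCommGroup (E x)] [∀ x, Module ℝ (E x)]
    [∀ x, TopologicalSpace (E x)]
    [TopologicalSpace (Bundle.TotalSpace (EuclideanSpace ℝ (Fin m)) E)]
    [FiberBundle (EuclideanSpace ℝ (Fin m)) E] [VectorBundle ℝ (EuclideanSpace ℝ (Fin m)) E]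
    [ContMDiffVectorBundle ∞ (EuclideanSpace ℝ (Fin m)) E (𝓡 n)]
    (A : LieAlgebroid n m M E)
    (F : Bundle.TotalSpace (EuclideanSpace ℝ (Fin m)) E → ℝ)
    (hF : IsFinslerFunction n F) (a : ℝ) (ha : 0 < a) :
    A.IsIntegrable F a ↔
      ∀ (c : LocalCoordinates n m M E), ∀ p ∈ c.domain, ∀ α β γ : Fin m,
        A.curvature F c α β γ p =
            1 / a ^ 2 * (c.lowerY F α p * (if β = γ then 1 else 0)
              - c.lowerY F β p * (if α = γ then 1 else 0)) ∧
        A.derivAlong c (A.delta F c α) (fun q => c.read F q ^ 2) p * (if β = γ then 1 else 0) =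
          A.derivAlong c (A.delta F c β) (fun q => c.read F q ^ 2) p *
            (if α = γ then 1 else 0) := by
  unfold LieAlgebroid.IsIntegrable
  refine forall_congr' fun c => ?_
  have hsq : ∀ p ∈ c.domain, ∀ α, A.derivAlong c (A.delta F c α) (fun q => c.read F q ^ 2) p =
      2 * c.read F p * A.derivAlong c (A.delta F c α) (c.read F) p := fun p hp α => by
    have hd := (c.contDiffAt_read hF hp).differentiableAt_infty
    simp only [pow_two]
    rw [A.derivAlong_mul c _ hd hd]; ring
  constructor
  · intro H p hp α β γ
    have hd := (c.contDiffAt_read hF hp).differentiableAt_infty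
    have hpos := c.read_pos hF hp
    have hN := fun α β => (A.contDiffAt_connection hF c hp α β).differentiableAt_infty
    have hT := A.partialY_connection_sub hF c hp
    have hα := LieAlgebroid.contDiffOn_delta (A := A) (c := c) hF α
    have hβ := LieAlgebroid.contDiffOn_delta (A := A) (c := c) hF β
    have hαp := LieAlgebroid.differentiableSectionAt_of_smoothOn hα hp
    have hβp := LieAlgebroid.differentiableSectionAt_of_smoothOn hβ hp
    -- The pair `δ_α, δ_β` alone yields both conditions: its horizontal part the one on `F²`, its
    -- vertical part the one on curvature.
    obtain ⟨h1, h2⟩ := (LieAlgebroid.nijenhuis_eq_zero_iff (A := A) (c := c) (F := F)).1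
      (H _ _ hα hβ p hp) γ
    rw [LieAlgebroid.nijenhuis_fst_eq ha.ne' hd hpos.ne' hN hT hαp hβp] at h1
    rw [LieAlgebroid.vert_nijenhuis_eq ha.ne' hd hpos.ne' hN hT hαp hβp] at h2
    -- Zero is written as `0 * 0` so that `bilinearSum_smul_left` and `bilinearSum_smul_right` can
    -- pull out a zero factor.
    have hv : ∀ α, A.vert c F (A.delta F c α) p = fun γ => (0 : ℝ) * 0 := fun α =>
      funext fun γ => by rw [A.vert_delta]; ring
    simp only [LieAlgebroid.derivAlong_almostComplex, hv, LieAlgebroid.delta_fst,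
      bilinearSum_smul_left, bilinearSum_smul_right, LieAlgebroid.bilinearSum_single] at h1 h2
    simp only [Pi.single_apply, zero_mul, Finset.sum_const_zero, mul_zero, ite_mul, one_mul,
      Finset.sum_ite_eq', Finset.mem_univ, if_true, eq_comm (a := γ)] at h1 h2
    rw [hsq p hp, hsq p hp, c.lowerY_eq hF hp, c.lowerY_eq hF hp]
    have hf := hpos.ne'
    have ha' := ha.ne'
    generalize (c.read F p) = f at *
    constructor
    · split_ifs at h2 ⊢ <;> linear_combination -h2
    · have h3 : 1 / f * ((if β = γ then A.derivAlong c (A.delta F c α) (c.read F) p else 0) -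
          if α = γ then A.derivAlong c (A.delta F c β) (c.read F) p else 0) = 0 := by
        linear_combination h1
      have h4 := (mul_eq_zero.1 h3).resolve_left (by positivity)
      split_ifs at h4 ⊢ <;> linear_combination 2 * f * h4
  · intro H z w hz hw p hp
    have hd := (c.contDiffAt_read hF hp).differentiableAt_infty
    have hpos := c.read_pos hF hp
    have hN := fun α β => (A.contDiffAt_connection hF c hp α β).differentiableAt_infty
    have hT := A.partialY_connection_sub hF c hp
    have hzp := LieAlgebroid.differentiableSectionAt_of_smoothOn hz hp
    have hwp := LieAlgebroid.differentiableSectionAt_of_smoothOn hw hp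
    refine (LieAlgebroid.nijenhuis_eq_zero_iff (A := A) (c := c) (F := F)).2 fun γ => ?_
    have hR : (fun α β => A.curvature F c α β γ p) = fun α β => 1 / a ^ 2 *
        (c.lowerY F α p * (if β = γ then 1 else 0) -
          c.lowerY F β p * (if α = γ then 1 else 0)) :=
      funext fun α => funext fun β => (H p hp α β γ).1
    have hy : ∀ x : Fin m → ℝ, ∑ α, x α * c.lowerY F α p =
        c.read F p * ∑ α, x α * partialY α (c.read F) p := fun x => by
      rw [Finset.mul_sum]
      exact Finset.sum_congr rfl fun α _ => by rw [c.lowerY_eq hF hp]; ring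
    -- The second condition, divided by `2F` and contracted with arbitrary `x` and `y`.
    have hH : ∀ x y : Fin m → ℝ,
        (∑ α, x α * A.derivAlong c (A.delta F c α) (c.read F) p) * y γ =
        (∑ α, y α * A.derivAlong c (A.delta F c α) (c.read F) p) * x γ := fun x y => by
      have h := LieAlgebroid.bilinearSum_wedge 1
        (fun α => A.derivAlong c (A.delta F c α) (c.read F) p) x y γ
      have h0 : ∀ α β, A.derivAlong c (A.delta F c α) (c.read F) p * (if β = γ then 1 else 0) -
          A.derivAlong c (A.delta F c β) (c.read F) p * (if α = γ then 1 else 0) = 0 :=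
        fun α β => by
          have h1 := (H p hp α β γ).2
          rw [hsq p hp, hsq p hp, mul_assoc (2 * _), mul_assoc (2 * _)] at h1
          exact sub_eq_zero.2 (mul_left_cancel₀ (mul_pos two_pos hpos).ne' h1)
      simp only [h0, mul_zero, bilinearSum, Finset.sum_const_zero, one_mul] at h
      exact sub_eq_zero.1 h.symm
    rw [LieAlgebroid.nijenhuis_fst_eq ha.ne' hd hpos.ne' hN hT hzp hwp,
      LieAlgebroid.vert_nijenhuis_eq ha.ne' hd hpos.ne' hN hT hzp hwp]
    simp only [hR, LieAlgebroid.bilinearSum_wedge, hy, LieAlgebroid.derivAlong_almostComplex]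
    rw [A.derivAlong_eq_adapted c F z, A.derivAlong_eq_adapted c F w]
    -- The curvature terms cancel the `∂F/∂y` terms identically. The remaining `δ(F)` terms pair
    -- horizontal with horizontal and vertical with vertical components in the horizontal part, and
    -- mixed components in the vertical part.
    have h1 := hH (z.1 p) (w.1 p)
    have h2 := hH (A.vert c F z p) (A.vert c F w p)
    have h3 := hH (z.1 p) (A.vert c F w p)
    have h4 := hH (w.1 p) (A.vert c F z p)
    have hf := hpos.ne'
    have ha' := ha.ne'
    generalize (c.read F p) = f at *
    constructor
    · field_simp
      linear_combination f ^ 2 * h1 - a ^ 2 * h2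
    · field_simp
      linear_combination a ^ 2 * (h4 - h3)
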